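/- Let $\epsilon_i$, $i\in\mathbb Z$, be i.i.d. real random variables, $(\epsilon_i^*)_{i\in\mathbb Z}$ an independent copy of this sequence, $\boldsymbol\epsilon_t=(\epsilon_t,\epsilon_{t-1},\ldots)$, and let $\tilde{\boldsymbol\epsilon}_{t,j}$ be $\boldsymbol\epsilon_t$ with the entry $\epsilon_{t-j}$ replaced by $\epsilon^*_{t-j}$. Let $G_n:\mathbb R\times\mathbb R^\infty\to\mathbb R^d$ ($n\ge 1$) be measurable, $X_{t,n}=G_n(t/n,\boldsymbol\epsilon_t)$ for $t=1,\ldots,n$, and $\mu^n_u=\mathbb E\,G_n(u,\boldsymbol\epsilon_0)$. Write $\|Z\|_{L_q}=(\mathbb E\|Z\|^q)^{1/q}$ with the Euclidean norm, and $x_n\ll y_n$ (or $y_n\gg x_n$) for $x_n/y_n\to0$. Assume that for some $q>2$, $\rho\in(0,1)$ and $C_G<\infty$, for all $n\ge1$, $j\ge 0$, $t\in\mathbb Z$ and $u\in[0,1]$, \[ \|G_n(u,\boldsymbol\epsilon_t)-G_n(u,\tilde{\boldsymbol\epsilon}_{t,j})\|_{L_q}\le C_G\,\rho^j \quad\text{(A.3)},\qquad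 \|G_n(u,\boldsymbol\epsilon_0)\|_{L_q}\le C_G . \] Let $k_n\in\mathbb N$ with $k_n\to\infty$, $k_n\ll n$, and let \[ \hat\mu^{NW}_{t,n}=\frac1{k_n\wedge t}\sum_{i=(t-k_n)\vee 1}^{t}X_{i,n}. \] (i) Suppose that $k_n\gg n^{2/q}$ and that $\sup_{u\in[0,1]}\|G_n(u,\boldsymbol\epsilon_0)-G(u,\boldsymbol\epsilon_0)\|_{L_q}\to0$ for a measurable kernel $G:\mathbb R\times\mathbb R^\infty\to\mathbb R^d$. Let $\mu_u=\mathbb E\,G(u,\boldsymbol\epsilon_0)$, let $\mathcal M$ be the convex hull of $\{\mu_u:u\in[0,1]\}$, and $\mathcal M^\delta=\{m:\|m-\tilde m\|<\delta\text{ for some }\tilde m\in\mathcal M\}$. Then for every $\delta\in(0,\infty]$ and every integer sequence $\tau_n\to\infty$, \[ P\big(\hat\mu^{NW}_{t,n}\in\mathcal M^\delta,\ t=\tau_n,\ldots,n\big)\to1 \quad\text{(A.6)}. \] (ii) Let $p\in[1,2)$, $\beta>0$, $C<\infty$ and $a_n\ge0$, and suppose that for all $n\ge 1$ we have $\mu^n_u=\mu^{n,1}_u+\mu^{n,2}_u$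 for $u\in[0,1]$, where $u\mapsto\mu^{n,1}_u$ is $\beta$-Hölder continuous on $[0,1]$ with constant $C$, and $\|\mu^{n,2}\|_{p\text{-var}}=\sup_{0=u_0<\cdots<u_m=1}\big(\sum_{i=1}^m\|\mu^{n,2}_{u_i}-\mu^{n,2}_{u_{i-1}}\|^p\big)^{1/p}\le a_n$. If the sequence $a_n$ is bounded, then \[ \frac1n\sum_{t=1}^n\big\|\hat\mu^{NW}_{t,n}-\mu^n_{t/n}\big\|^2=\mathcal O_P\Big(\frac{a_nk_n}n+\Big(\frac{k_n}n\Big)^{2\beta}+\frac{\log n}{k_n}\Big). \] (iii) In particular, in the situation of (ii), if $a_nk_n\ll\sqrt n$ and $\sqrt n\log n\ll k_n\ll n^{\frac{4\beta-1}{4\beta}}$, then for every integer sequence $\tau_n\ge1$, \[ \sum_{t=\tau_n}^n\big\|\hat\mu^{NW}_{t,n}-\mu^n_{t/n}\big\|^2=o_P(\sqrt n)\quad\text{(A.5)}. \] (Boundedness of $a_n$ need not be assumed separately here.) (iv) For every $\beta>\frac12$ there is a sequence $k_n\in\mathbb N$ with $\sqrt n\log n\ll k_n\ll n^{\frac{4\beta-1}{4\beta}}$.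 -/

import Mathlib

open MeasureTheory ProbabilityTheory Filter Topology Asymptotics
open scoped NNReal ENNReal

noncomputable section

namespace LocStat

/-- The innovations `ε i`, `i ∈ ℤ`, and their copies `ε' i`, `i ∈ ℤ`: real random variables that are
all mutually independent and all identically distributed. -/
structure IIDWithCopy {Ω : Type*} [MeasurableSpace Ω] (P : Measure Ω) (ε ε' : ℤ → Ω → ℝ) : Prop where
  measurable : ∀ i, Measurable (ε i)
  measurable_copy : ∀ i, Measurable (ε' i)
  indep : iIndepFun (Sum.elim ε ε') P
  ident : ∀ i, IdentDistrib (ε i) (ε 0) P P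
  ident_copy : ∀ i, IdentDistrib (ε' i) (ε 0) P P

/-- The sequence of innovations up to time `t`: `(ε_t, ε_{t-1}, ε_{t-2}, …)`. -/
def past {Ω : Type*} (ε : ℤ → Ω → ℝ) (t : ℤ) (ω : Ω) : ℕ → ℝ :=
  fun i => ε (t - i) ω

/-- The same sequence with the single entry `ε_{t-j}` replaced by its copy:
`(ε_t, …, ε_{t-j+1}, ε'_{t-j}, ε_{t-j-1}, …)`. -/
def pastReplace {Ω : Type*} (ε ε' : ℤ → Ω → ℝ) (t : ℤ) (j : ℕ) (ω : Ω) : ℕ → ℝ :=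
  fun i => if i = j then ε' (t - i) ω else ε (t - i) ω

/-- Uniform geometric ergodicity, for the physical dependence measure:
`‖G_n(u, ε_t, ε_{t-1}, …) - G_n(u, …, ε'_{t-j}, …)‖_{L_q} ≤ C_G ρ ^ j` for all `n`, `j`, `u`. -/
def UniformlyErgodic {Ω : Type*} [MeasurableSpace Ω] (P : Measure Ω) (ε ε' : ℤ → Ω → ℝ) {d : ℕ}
    (G : ℕ → ℝ → (ℕ → ℝ) → EuclideanSpace ℝ (Fin d)) (q CG ρ : ℝ) : Prop :=
  ∀ n : ℕ, 1 ≤ n → ∀ u ∈ Set.Icc (0 : ℝ) 1, ∀ (t : ℤ) (j : ℕ),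
    eLpNorm (fun ω => G n u (past ε t ω) - G n u (pastReplace ε ε' t j ω)) (ENNReal.ofReal q) P
      ≤ ENNReal.ofReal (CG * ρ ^ j)

/-- Uniformly bounded moments: `‖G_n(u, ε_0, ε_{-1}, …)‖_{L_q} ≤ C_G` for all `n`, `u`. -/
def UniformlyBoundedMoments {Ω : Type*} [MeasurableSpace Ω] (P : Measure Ω) (ε : ℤ → Ω → ℝ) {d : ℕ}
    (G : ℕ → ℝ → (ℕ → ℝ) → EuclideanSpace ℝ (Fin d)) (q CG : ℝ) : Prop :=
  ∀ n : ℕ, 1 ≤ n → ∀ u ∈ Set.Icc (0 : ℝ) 1,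
    eLpNorm (fun ω => G n u (past ε 0 ω)) (ENNReal.ofReal q) P ≤ ENNReal.ofReal CG

/-- Convergence of the kernels:
`sup_{u ∈ [0,1]} ‖G_n(u, ε_0, ε_{-1}, …) - G(u, ε_0, ε_{-1}, …)‖_{L_q} → 0`. -/
def KernelConverges {Ω : Type*} [MeasurableSpace Ω] (P : Measure Ω) (ε : ℤ → Ω → ℝ) {d : ℕ}
    (G : ℕ → ℝ → (ℕ → ℝ) → EuclideanSpace ℝ (Fin d))
    (Glim : ℝ → (ℕ → ℝ) → EuclideanSpace ℝ (Fin d)) (q : ℝ) : Prop :=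
  Tendsto (fun n : ℕ => ⨆ u ∈ Set.Icc (0 : ℝ) 1,
    eLpNorm (fun ω => G n u (past ε 0 ω) - Glim u (past ε 0 ω)) (ENNReal.ofReal q) P) atTop (𝓝 0)

/-- The local mean `E H(u, ε_0, ε_{-1}, …)` of a kernel `H`. -/
def localMean {Ω : Type*} [MeasurableSpace Ω] (P : Measure Ω) (ε : ℤ → Ω → ℝ) {d : ℕ}
    (H : ℝ → (ℕ → ℝ) → EuclideanSpace ℝ (Fin d)) (u : ℝ) : EuclideanSpace ℝ (Fin d) :=
  ∫ ω, H u (past ε 0 ω) ∂P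

/-- The triangular array `X_{t,n} = G_n(t/n, ε_t, ε_{t-1}, …)`. -/
def obs {Ω : Type*} (ε : ℤ → Ω → ℝ) {d : ℕ}
    (G : ℕ → ℝ → (ℕ → ℝ) → EuclideanSpace ℝ (Fin d)) (n t : ℕ) (ω : Ω) :
    EuclideanSpace ℝ (Fin d) :=
  G n ((t : ℝ) / n) (past ε t ω)

/-- The one-sided local average with bandwidth `k`:
`(k ∧ t)⁻¹ ∑_{i = (t - k) ∨ 1}^{t} X_{i,n}`. -/
def localAverage {Ω : Type*} (ε : ℤ → Ω → ℝ) {d : ℕ}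
    (G : ℕ → ℝ → (ℕ → ℝ) → EuclideanSpace ℝ (Fin d)) (k n t : ℕ) (ω : Ω) :
    EuclideanSpace ℝ (Fin d) :=
  ((min k t : ℕ) : ℝ)⁻¹ • ∑ i ∈ Finset.Icc (max (t - k) 1) t, obs ε G n i ω

/-- The convex hull of the path `{μ_u : u ∈ [0,1]}`. -/
def pathHull {d : ℕ} (μ : ℝ → EuclideanSpace ℝ (Fin d)) : Set (EuclideanSpace ℝ (Fin d)) :=
  convexHull ℝ (μ '' Set.Icc (0 : ℝ) 1)

/-- The open `δ`-neighbourhood of a set, where `δ = ∞` is allowed. -/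
def neighborhood {d : ℕ} (δ : ℝ≥0∞) (M : Set (EuclideanSpace ℝ (Fin d))) :
    Set (EuclideanSpace ℝ (Fin d)) :=
  {m | ∃ m' ∈ M, edist m m' < δ}

/-- The `p`-variation on `[0,1]` of a function, as an extended nonnegative number: the supremum over
all partitions `0 = u_0 < u_1 < … < u_m = 1` of `(∑ ‖f(u_i) - f(u_{i-1})‖ ^ p) ^ (1/p)`. -/
def pVariation {d : ℕ} (p : ℝ) (f : ℝ → EuclideanSpace ℝ (Fin d)) : ℝ≥0∞ :=
  ⨆ (m : ℕ) (u : ℕ → ℝ) (_ : u 0 = 0 ∧ u m = 1 ∧ StrictMonoOn u (Set.Iic m)),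
    ENNReal.ofReal ((∑ i ∈ Finset.range m, ‖f (u (i + 1)) - f (u i)‖ ^ p) ^ (1 / p))

/-- `Y_n = O_P(r_n)`: for every `η > 0` there is `K` with `P(|Y_n| > K r_n) ≤ η` for all large `n`. -/
def IsBigOP {Ω : Type*} [MeasurableSpace Ω] (P : Measure Ω) (Y : ℕ → Ω → ℝ) (r : ℕ → ℝ) : Prop :=
  ∀ η : ℝ, 0 < η → ∃ K : ℝ, ∀ᶠ n in atTop, P {ω | K * r n < |Y n ω|} ≤ ENNReal.ofReal η

/-- `Y_n = o_P(r_n)`: `Y_n / r_n → 0` in probability. -/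
def IsLittleOP {Ω : Type*} [MeasurableSpace Ω] (P : Measure Ω) (Y : ℕ → Ω → ℝ) (r : ℕ → ℝ) : Prop :=
  TendstoInMeasure P (fun n ω => Y n ω / r n) atTop (fun _ => 0)

/-- The squared-error consistency condition
`∑_{t = τ_n}^n ‖μ̂_{t,n} - μ^n_{t/n}‖² = o_P(√n)` for an estimator `μhat n t` of `μ n (t/n)`. -/
def SquaredErrorConsistent {Ω : Type*} [MeasurableSpace Ω] (P : Measure Ω) {d : ℕ}
    (μhat : ℕ → ℕ → Ω → EuclideanSpace ℝ (Fin d)) (μ : ℕ → ℝ → EuclideanSpace ℝ (Fin d))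
    (τ : ℕ → ℕ) : Prop :=
  IsLittleOP P (fun n ω => ∑ t ∈ Finset.Icc (τ n) n, ‖μhat n t ω - μ n ((t : ℝ) / n)‖ ^ 2)
    (fun n => Real.sqrt n)

/-- The uniform-consistency condition `P(μ̂_{t,n} ∈ M^δ for t = τ_n, …, n) → 1`, where `M^δ` is the
`δ`-neighbourhood of the convex hull of the limiting path. -/
def UniformlyConsistent {Ω : Type*} [MeasurableSpace Ω] (P : Measure Ω) {d : ℕ}
    (μhat : ℕ → ℕ → Ω → EuclideanSpace ℝ (Fin d)) (μlim : ℝ → EuclideanSpace ℝ (Fin d))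
    (δ : ℝ≥0∞) (τ : ℕ → ℕ) : Prop :=
  Tendsto (fun n : ℕ =>
    P {ω | ∀ t : ℕ, τ n ≤ t → t ≤ n → μhat n t ω ∈ neighborhood δ (pathHull μlim)}) atTop (𝓝 1)

end LocStat

end

open LocStat

open LocStat

/-! The estimation error splits into a stochastic part, the local average minus its mean, and a
deterministic bias.

Stochastic part. A partial sum of N observations has centred L_q norm O(√N), uniformly in n and in
the window (`IIDWithCopy.exists_sum_moment_bound`). Each summand is revealed by conditioning on its
last J innovations and letting J grow. By the coupling with a copied innovation, passing from depth
j to depth j + 1 changes the conditional expectation by at most C_G ρ^j in L_q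
(`IIDWithCopy.eLpNorm_condExp_future_sub_le`). At a fixed depth these changes, taken along the
summands backwards in time, are martingale differences, so `exists_martingale_rpow_moment_bound`
gives √N ρ^j, and the geometric series in j converges. The local average therefore has error O((k ∧
t)^(-1/2)) in L_q (`IIDWithCopy.exists_localAverage_bound`).

Bias. The Hölder part contributes (k/n)^β pointwise. The squared bias of the p-variation part,
summed over t, is at most 2 k a² (`sum_windowAverage_sub_sq_le_of_pVariation_le`): increments of lag
h split into h residue classes, each of which is a partition.

Conclusions. Squared errors are summed over t, where the harmonic sum of 1/(k ∧ t) produces log n,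
and Markov's inequality gives the rates. For uniform consistency, a union bound with q-th moments
costs n k^(-q/2) plus a tail of the convergent series of t^(-q/2), while the window average of the
limiting means lies in the convex hull. -/

/-! ### Moment inequality for martingales with exponent q ≥ 2. -/

theorem rpow_le_one_add_tangent {w r : ℝ} (hw : 0 ≤ w) (hr : 1 ≤ r) :
    w ^ r ≤ 1 + r * (w - 1) * w ^ (r - 1) := by
  rcases hw.eq_or_lt with rfl | hw
  · rcases hr.eq_or_lt with rfl | hr
    · norm_num
    · rw [Real.zero_rpow (by linarith), Real.zero_rpow (by linarith)]; norm_num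
  -- Bernoulli at `w⁻¹`, multiplied by `w ^ r`, says that the tangent of the convex power at `w`
  -- lies below it at 1.
  · have h := one_add_mul_self_le_rpow_one_add (s := w⁻¹ - 1) (p := r)
      (by linarith [inv_pos.mpr hw]) hr
    have h2 : w ^ r * w⁻¹ ^ r = 1 := by
      rw [← Real.mul_rpow hw.le (inv_nonneg.mpr hw.le), mul_inv_cancel₀ hw.ne', Real.one_rpow]
    have h3 : w ^ r = w * w ^ (r - 1) := by
      rw [Real.rpow_sub_one hw.ne']; field_simp
    have h4 : 0 < w ^ r := Real.rpow_pos_of_pos hw _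
    have h5 := mul_le_mul_of_nonneg_left h h4.le
    rw [add_sub_cancel, h2] at h5
    have h6 : w ^ r * (1 + r * (w⁻¹ - 1)) = w ^ r + r * (1 - w) * w ^ (r - 1) := by
      rw [h3]; field_simp
    linarith

/-- The tangent bound leaves a factor (1 + s)^(q-1) in the linear term. Comparing that factor with
1, by a second tangent bound if s ≥ 0 and by Bernoulli if s ≤ 0, costs a term in s²; 2^q dominates
(1 + s)^(q-2). -/
theorem one_add_rpow_le_quadratic {s q : ℝ} (hq : 2 ≤ q) (hs : |s| ≤ 1) :
    (1 + s) ^ q ≤ 1 + q * s + q * (q - 1) * 2 ^ q * s ^ 2 := by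
  obtain ⟨h1, h2⟩ := abs_le.mp hs
  have hw : 0 ≤ 1 + s := by linarith
  have ht := rpow_le_one_add_tangent hw (r := q) (by linarith)
  rw [add_sub_cancel_left] at ht
  refine ht.trans ?_
  have hqq : 0 ≤ q * (q - 1) * s ^ 2 := by
    have : 0 ≤ q - 1 := by linarith
    positivity
  have h2q : (1 : ℝ) ≤ 2 ^ q := Real.one_le_rpow (by norm_num) (by linarith)
  rcases le_total 0 s with h | h
  · have h3 := rpow_le_one_add_tangent hw (r := q - 1) (by linarith)
    have h4 : (1 + s) ^ (q - 1 - 1) ≤ 2 ^ q :=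
      (Real.rpow_le_rpow hw (by linarith) (by linarith)).trans
        (Real.rpow_le_rpow_of_exponent_le (by norm_num) (by linarith))
    rw [add_sub_cancel_left] at h3
    have h5 : (q - 1) * s * (1 + s) ^ (q - 1 - 1) ≤ (q - 1) * s * 2 ^ q :=
      mul_le_mul_of_nonneg_left h4 (mul_nonneg (by linarith) h)
    have h6 : q * s * (1 + s) ^ (q - 1) ≤ q * s * (1 + (q - 1) * s * 2 ^ q) :=
      mul_le_mul_of_nonneg_left (h3.trans (by linarith)) (mul_nonneg (by linarith) h)
    nlinarith [h6]
  · have h3 := one_add_mul_self_le_rpow_one_add h1 (p := q - 1) (by linarith)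
    have h6 : q * s * (1 + s) ^ (q - 1) ≤ q * s * (1 + (q - 1) * s) :=
      mul_le_mul_of_nonpos_left h3 (mul_nonpos_of_nonneg_of_nonpos (by linarith) h)
    nlinarith [mul_le_mul_of_nonneg_left h2q hqq]

theorem rpow_sub_two_mul_sq {a q : ℝ} (hq : 2 ≤ q) (ha : 0 ≤ a) : a ^ (q - 2) * a ^ 2 = a ^ q := by
  rw [← Real.rpow_natCast a 2, ← Real.rpow_add_of_nonneg ha (by linarith) (by norm_num)]
  norm_num

/-- Second-order expansion of |·|^q whose linear term is a function of x times y, so that it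
disappears under conditional expectation. For |x| ≤ |y| crude bounds suffice; otherwise homogeneity
reduces to 1 + s with |s| ≤ 1. -/
theorem exists_abs_add_rpow_le {q : ℝ} (hq : 2 ≤ q) :
    ∃ C : ℝ, 0 < C ∧ ∀ x y : ℝ, |x + y| ^ q ≤
      |x| ^ q + q * ((|x| ^ (q - 2) * x) * y) + C * (|x| ^ (q - 2) * y ^ 2 + |y| ^ q) := by
  have h2q : (0 : ℝ) < 2 ^ q := by positivity
  have hC2 : 0 ≤ q * (q - 1) * 2 ^ q :=
    mul_nonneg (mul_nonneg (by linarith) (by linarith)) h2q.le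
  refine ⟨2 ^ q + q + q * (q - 1) * 2 ^ q, by positivity, fun x y => ?_⟩
  have hx2 : 0 ≤ |x| ^ (q - 2) := by positivity
  have hyq : 0 ≤ |y| ^ q := by positivity
  rcases le_or_gt |x| |y| with h | h
  · have h1 : |x + y| ^ q ≤ 2 ^ q * |y| ^ q := by
      rw [← Real.mul_rpow (by norm_num) (abs_nonneg _)]
      exact Real.rpow_le_rpow (abs_nonneg _) ((abs_add_le x y).trans (by linarith)) (by linarith)
    have h2 : |(|x| ^ (q - 2) * x) * y| ≤ |y| ^ q := by
      rw [abs_mul, abs_mul, abs_of_nonneg hx2, ← rpow_sub_two_mul_sq hq (abs_nonneg y), mul_assoc,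
        sq]
      gcongr
    have h3 := mul_le_mul_of_nonneg_left (abs_le.mp h2).1 (show 0 ≤ q by linarith)
    have h4 : 0 ≤ |x| ^ q := by positivity
    have h5 : 0 ≤ (2 ^ q + q + q * (q - 1) * 2 ^ q) * (|x| ^ (q - 2) * y ^ 2) := by positivity
    nlinarith [mul_nonneg hC2 hyq]
  · have hx : x ≠ 0 := by
      rintro rfl
      simp at h
      exact absurd h (not_lt.mpr (abs_nonneg y))
    have hx' : 0 < |x| := abs_pos.mpr hx
    obtain ⟨s, rfl⟩ : ∃ s, y = x * s := ⟨y / x, by field_simp⟩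
    have hs : |s| ≤ 1 := by
      rw [abs_mul] at h
      nlinarith
    have h1 : |x + x * s| ^ q = |x| ^ q * (1 + s) ^ q := by
      rw [show x + x * s = x * (1 + s) by ring, abs_mul, Real.mul_rpow hx'.le (abs_nonneg _),
        abs_of_nonneg (show 0 ≤ 1 + s by linarith [(abs_le.mp hs).1])]
    have h2 := one_add_rpow_le_quadratic hq hs
    have h3 := rpow_sub_two_mul_sq hq hx'.le
    rw [sq_abs] at h3
    have h4 := mul_le_mul_of_nonneg_left h2 (show 0 ≤ |x| ^ q by positivity)
    rw [h1]
    have h5 : |x| ^ (q - 2) * x * (x * s) = |x| ^ q * s := by rw [← h3]; ring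
    have h6 : |x| ^ (q - 2) * (x * s) ^ 2 = |x| ^ q * s ^ 2 := by rw [← h3]; ring
    rw [h5, h6]
    have h7 : 0 ≤ (2 ^ q + q) * (|x| ^ q * s ^ 2) := by positivity
    have h8 : 0 ≤ (2 ^ q + q + q * (q - 1) * 2 ^ q) * |x * s| ^ q := by positivity
    nlinarith

/-- Young's inequality with a free weight, by comparing b² with a²/c. Later c is of order n, so that
the a^q term costs only a factor 1/n. -/
theorem rpow_mul_sq_le_weighted {q a b c : ℝ} (hq : 2 ≤ q) (ha : 0 ≤ a) (hb : 0 ≤ b)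
    (hc : 0 < c) :
    a ^ (q - 2) * b ^ 2 ≤ c⁻¹ * a ^ q + c ^ ((q - 2) / 2) * b ^ q := by
  have hbq : 0 ≤ c ^ ((q - 2) / 2) * b ^ q := by positivity
  have haq : 0 ≤ c⁻¹ * a ^ q := by positivity
  rcases le_total (b ^ 2) (c⁻¹ * a ^ 2) with h | h
  · have := mul_le_mul_of_nonneg_left h (show 0 ≤ a ^ (q - 2) by positivity)
    rw [mul_left_comm, rpow_sub_two_mul_sq hq ha] at this
    linarith
  · have h1 : a ^ 2 ≤ c * b ^ 2 := by
      rw [inv_mul_le_iff₀ hc] at h; exact h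
    have h2 : a ^ (q - 2) ≤ c ^ ((q - 2) / 2) * b ^ (q - 2) := by
      have e : ∀ z : ℝ, 0 ≤ z → z ^ (q - 2) = (z ^ 2) ^ ((q - 2) / 2) := fun z hz => by
        rw [← Real.rpow_natCast z 2, ← Real.rpow_mul hz]
        push_cast
        ring_nf
      rw [e a ha, e b hb, ← Real.mul_rpow hc.le (sq_nonneg _)]
      exact Real.rpow_le_rpow (sq_nonneg _) h1 (by linarith)
    have h3 := mul_le_mul_of_nonneg_right h2 (sq_nonneg b)
    rw [mul_assoc, rpow_sub_two_mul_sq hq hb] at h3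
    linarith

theorem integrable_abs_rpow {Ω : Type*} [MeasurableSpace Ω] {P : Measure Ω}
    [IsFiniteMeasure P] {q : ℝ} (hq : 0 < q) {f : Ω → ℝ}
    (hf : MemLp f (ENNReal.ofReal q) P) : Integrable (fun ω => |f ω| ^ q) P := by
  have := hf.integrable_norm_rpow (by simpa using hq) ENNReal.ofReal_ne_top
  simpa [ENNReal.toReal_ofReal hq.le] using this

/-- One martingale step: the linear term integrates to zero, since its first factor is m-measurable
and D has conditional mean zero. -/
theorem integral_abs_add_rpow_le {Ω : Type*} {m m0 : MeasurableSpace Ω} {P : Measure Ω}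
    [IsProbabilityMeasure P] {q C : ℝ} (hq : 2 ≤ q) (hC0 : 0 < C)
    (hC : ∀ x y : ℝ, |x + y| ^ q ≤
      |x| ^ q + q * ((|x| ^ (q - 2) * x) * y) + C * (|x| ^ (q - 2) * y ^ 2 + |y| ^ q))
    (hm : m ≤ m0) {S D : Ω → ℝ} (hSm : StronglyMeasurable[m] S)
    (hS : MemLp S (ENNReal.ofReal q) P) (hD : MemLp D (ENNReal.ofReal q) P)
    (hSD : P[D | m] =ᵐ[P] 0) {c : ℝ} (hc : 0 < c) :
    ∫ ω, |S ω + D ω| ^ q ∂P ≤ ∫ ω, |S ω| ^ q ∂P +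
      C * (c⁻¹ * ∫ ω, |S ω| ^ q ∂P + (c ^ ((q - 2) / 2) + 1) * ∫ ω, |D ω| ^ q ∂P) := by
  have hq0 : 0 < q := by linarith
  have h1q : (1 : ℝ≥0∞) ≤ ENNReal.ofReal q := by
    rw [← ENNReal.ofReal_one]; exact ENNReal.ofReal_le_ofReal (by linarith)
  have iS := integrable_abs_rpow hq0 hS
  have iD := integrable_abs_rpow hq0 hD
  have iDD : Integrable D P := hD.integrable h1q
  set H : Ω → ℝ := fun ω => |S ω| ^ (q - 2) * S ω with hH
  have hHm : StronglyMeasurable[m] H := by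
    have hS' : Measurable[m] S := hSm.measurable
    have : Measurable[m] H := by
      refine Measurable.mul ?_ hS'
      exact Measurable.pow_const (measurable_abs.comp hS') _
    exact this.stronglyMeasurable
  have iHD : Integrable (fun ω => H ω * D ω) P := by
    refine (iS.add iD).mono' ((hHm.mono hm).aestronglyMeasurable.mul hD.1) (ae_of_all _ fun ω => ?_)
    have h1 := rpow_sub_two_mul_sq hq (abs_nonneg (S ω))
    have h2 := rpow_sub_two_mul_sq hq (abs_nonneg (D ω))
    have hSq : 0 ≤ |S ω| ^ q := by positivity
    have hDq : 0 ≤ |D ω| ^ q := by positivity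
    rw [Real.norm_eq_abs, hH, Pi.add_apply]
    simp only
    rw [abs_mul, abs_mul, abs_of_nonneg (show 0 ≤ |S ω| ^ (q - 2) by positivity)]
    rcases le_total |S ω| |D ω| with h | h
    · calc |S ω| ^ (q - 2) * |S ω| * |D ω| ≤ |D ω| ^ (q - 2) * |D ω| * |D ω| := by
            gcongr
        _ ≤ _ := by rw [mul_assoc, ← sq, h2]; linarith
    · calc |S ω| ^ (q - 2) * |S ω| * |D ω| ≤ |S ω| ^ (q - 2) * |S ω| * |S ω| := by
            gcongr
        _ ≤ _ := by rw [mul_assoc, ← sq, h1]; linarith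
  have hzero : ∫ ω, H ω * D ω ∂P = 0 := by
    rw [← integral_condExp hm]
    have h1 : P[fun ω => H ω * D ω | m] =ᵐ[P] H * P[D | m] :=
      condExp_mul_of_stronglyMeasurable_left hHm iHD iDD
    rw [integral_congr_ae (g := fun _ => 0)]
    · simp
    · filter_upwards [h1, hSD] with ω h h'
      rw [h, Pi.mul_apply, h']; simp
  have iSD := integrable_abs_rpow hq0 (hS.add hD)
  have iR : Integrable (fun ω => C * (c⁻¹ * |S ω| ^ q +
      (c ^ ((q - 2) / 2) + 1) * |D ω| ^ q)) P :=
    ((iS.const_mul _).add (iD.const_mul _)).const_mul C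
  calc ∫ ω, |S ω + D ω| ^ q ∂P
      ≤ ∫ ω, (|S ω| ^ q + q * (H ω * D ω) + C * (c⁻¹ * |S ω| ^ q +
          (c ^ ((q - 2) / 2) + 1) * |D ω| ^ q)) ∂P := by
        refine integral_mono iSD
          ((iS.add (iHD.const_mul q)).add iR)
          fun ω => ?_
        have h1 := hC (S ω) (D ω)
        have h2 := rpow_mul_sq_le_weighted hq (abs_nonneg (S ω)) (abs_nonneg (D ω)) hc
        rw [sq_abs] at h2
        have h3 : C * (|S ω| ^ (q - 2) * D ω ^ 2 + |D ω| ^ q) ≤ C * (c⁻¹ * |S ω| ^ q +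
          (c ^ ((q - 2) / 2) + 1) * |D ω| ^ q) := mul_le_mul_of_nonneg_left (by linarith) hC0.le
        simp only [hH]
        linarith
    _ = _ := by
        rw [integral_add (f := fun ω => |S ω| ^ q + q * (H ω * D ω)) (iS.add (iHD.const_mul q))
          iR,
          integral_add iS (iHD.const_mul q), integral_const_mul, integral_const_mul,
          integral_add (iS.const_mul _) (iD.const_mul _), integral_const_mul, integral_const_mul,
          hzero]
        ring

theorem exists_martingale_rpow_moment_bound {Ω : Type*} {m0 : MeasurableSpace Ω} (P : Measure Ω) [IsProbabilityMeasure P] {q : ℝ}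
    (hq : 2 ≤ q) :
    ∃ K : ℝ, 0 < K ∧ ∀ (𝒢 : ℕ → MeasurableSpace Ω) (D : ℕ → Ω → ℝ) (M : ℝ),
      Monotone 𝒢 → (∀ i, 𝒢 i ≤ m0) → (∀ i, StronglyMeasurable[𝒢 (i + 1)] (D i)) →
      (∀ i, MemLp (D i) (ENNReal.ofReal q) P) → (∀ i, P[D i | 𝒢 i] =ᵐ[P] 0) →
      (∀ i, ∫ ω, |D i ω| ^ q ∂P ≤ M) → ∀ n : ℕ,
      ∫ ω, |∑ i ∈ Finset.range n, D i ω| ^ q ∂P ≤ K * (n : ℝ) ^ (q / 2) * M := by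
  obtain ⟨C, hC0, hC⟩ := exists_abs_add_rpow_le hq
  set B : ℝ := (2 * C) ^ ((q - 2) / 2) + 1 with hB
  have hB0 : 0 < B := by positivity
  have hK0 : 0 < 1 + 2 * C * B := by positivity
  refine ⟨1 + 2 * C * B, hK0, fun 𝒢 D M hmono hle hDm hDq hD0 hDM n => ?_⟩
  have hM : 0 ≤ M := (integral_nonneg fun ω => by positivity).trans (hDM 0)
  induction n with
  | zero =>
    have h0 : q ≠ 0 := by linarith
    have h1 : q / 2 ≠ 0 := by linarith
    simp [Real.zero_rpow h0, Real.zero_rpow h1]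
  | succ n ih =>
    rcases Nat.eq_zero_or_pos n with rfl | hn
    · simp only [zero_add, Finset.range_one, Finset.sum_singleton, Nat.cast_one, Real.one_rpow,
        mul_one]
      refine (hDM 0).trans ?_
      have : 0 ≤ 2 * C * B * M := by positivity
      nlinarith
    · have hn' : (1 : ℝ) ≤ n := by exact_mod_cast hn
      have hSm : StronglyMeasurable[𝒢 n] (fun ω => ∑ i ∈ Finset.range n, D i ω) := by
        refine Finset.stronglyMeasurable_fun_sum _ fun i hi => (hDm i).mono (hmono ?_)
        have := Finset.mem_range.mp hi
        omega
      have hS : MemLp (fun ω => ∑ i ∈ Finset.range n, D i ω) (ENNReal.ofReal q) P :=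
        memLp_finsetSum _ fun i _ => hDq i
      -- This weight multiplies the previous moment by 1 + 1/(2n). The step then adds at most half
      -- of K n^(q/2-1) M, plus C B n^(q/2-1) M; both fit since K = 1 + 2CB. Positivity of the
      -- weight is why the step from n = 0 is treated apart.
      have hstep := integral_abs_add_rpow_le hq hC0 hC (hle n) hSm hS (hDq n) (hD0 n)
        (c := 2 * C * n) (by positivity)
      simp only [Finset.sum_range_succ]
      refine hstep.trans ?_
      set e := ∫ ω, |∑ i ∈ Finset.range n, D i ω| ^ q ∂P
      set p : ℝ := (n : ℝ) ^ ((q - 2) / 2) with hp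
      have hp1 : 1 ≤ p := Real.one_le_rpow hn' (by linarith)
      have hpq : (n : ℝ) ^ (q / 2) = n * p := by
        rw [hp, mul_comm, ← Real.rpow_add_one (by positivity)]; ring_nf
      -- Bernoulli gives (1 + 1/n)^(q/2) ≥ 1 + 1/n, so n^(q/2) grows by at least n^(q/2-1) per step.
      have hgrow : (n : ℝ) * p + p ≤ ((n + 1 : ℕ) : ℝ) ^ (q / 2) := by
        have h1 := one_add_mul_self_le_rpow_one_add (s := (n : ℝ)⁻¹) (p := q / 2)
          (by have : (0 : ℝ) ≤ (n : ℝ)⁻¹ := by positivity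
              linarith) (by linarith)
        have h2 : ((n + 1 : ℕ) : ℝ) ^ (q / 2) = n * p * (1 + (n : ℝ)⁻¹) ^ (q / 2) := by
          rw [← hpq, ← Real.mul_rpow (by positivity) (by positivity)]
          congr 1
          push_cast
          field_simp
        rw [h2]
        calc (n : ℝ) * p + p = n * p * (1 + 1 * (n : ℝ)⁻¹) := by field_simp
          _ ≤ _ := by
            refine mul_le_mul_of_nonneg_left (le_trans ?_ h1) (by positivity)
            have : (1 : ℝ) ≤ q / 2 := by linarith
            gcongr
      have h2 : (2 * C * n : ℝ) ^ ((q - 2) / 2) + 1 ≤ B * p := by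
        rw [Real.mul_rpow (by positivity) (by positivity), hB, add_mul, one_mul]
        linarith
      have h3 : C * ((2 * C * n)⁻¹ * e) ≤ (1 + 2 * C * B) * p * M / 2 := by
        rw [hpq] at ih
        have : C * ((2 * C * n)⁻¹ * e) = e / n / 2 := by field_simp
        rw [this]
        have h4 : e / n ≤ (1 + 2 * C * B) * p * M := by
          rw [div_le_iff₀ (by positivity)]
          linarith
        linarith
      have h4 : C * (((2 * C * n : ℝ) ^ ((q - 2) / 2) + 1) * ∫ ω, |D n ω| ^ q ∂P)
          ≤ C * (B * p * M) := by
        have h0 : 0 ≤ ∫ ω, |D n ω| ^ q ∂P := integral_nonneg fun ω => by positivity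
        have h5 := hDM n
        gcongr
      rw [hpq] at ih
      have h5 : (1 + 2 * C * B) * ((n : ℝ) * p + p) * M ≤
          (1 + 2 * C * B) * ((n + 1 : ℕ) : ℝ) ^ (q / 2) * M := by gcongr
      refine le_trans ?_ h5
      rw [mul_add C]
      have h6 : 0 ≤ p * M := by positivity
      nlinarith

/-! ### Conditioning on a join with an independent σ-algebra. -/

theorem generateFrom_inter_eq_sup {Ω : Type*} (m₁ m₂ : MeasurableSpace Ω) :
    m₁ ⊔ m₂ = MeasurableSpace.generateFrom
      {s | ∃ A B, MeasurableSet[m₁] A ∧ MeasurableSet[m₂] B ∧ A ∩ B = s} := by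
  apply le_antisymm
  · refine sup_le (fun A hA => ?_) (fun B hB => ?_)
    · exact MeasurableSpace.measurableSet_generateFrom
        ⟨A, Set.univ, hA, MeasurableSet.univ, Set.inter_univ A⟩
    · exact MeasurableSpace.measurableSet_generateFrom
        ⟨Set.univ, B, MeasurableSet.univ, hB, Set.univ_inter B⟩
  · refine MeasurableSpace.generateFrom_le ?_
    rintro _ ⟨A, B, hA, hB, rfl⟩
    exact MeasurableSet.inter ((le_sup_left : m₁ ≤ m₁ ⊔ m₂) A hA)
      ((le_sup_right : m₂ ≤ m₁ ⊔ m₂) B hB)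

theorem isPiSystem_inter_measurableSet {Ω : Type*} (m₁ m₂ : MeasurableSpace Ω) :
    IsPiSystem {s | ∃ A B, MeasurableSet[m₁] A ∧ MeasurableSet[m₂] B ∧ A ∩ B = s} := by
  rintro _ ⟨A, B, hA, hB, rfl⟩ _ ⟨A', B', hA', hB', rfl⟩ _
  exact ⟨A ∩ A', B ∩ B', hA.inter hA', hB.inter hB', Set.inter_inter_inter_comm _ _ _ _⟩

/-- Conditionally on m₁, the variable f restricted to B is independent noise, so its conditional
expectation is constant. -/
theorem setIntegral_inter_of_indep {Ω : Type*} {m₁ m₂ m0 : MeasurableSpace Ω} {P : Measure Ω}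
    [IsProbabilityMeasure P] (h₁ : m₁ ≤ m0) (h₂ : m₂ ≤ m0) (hind : Indep m₂ m₁ P) {f : Ω → ℝ}
    (hf : StronglyMeasurable[m₂] f) (hfi : Integrable f P) {A B : Set Ω}
    (hA : MeasurableSet[m₁] A) (hB : MeasurableSet[m₂] B) :
    ∫ ω in A ∩ B, f ω ∂P = P.real A * ∫ ω in B, f ω ∂P := by
  have hB0 := h₂ B hB
  rw [← setIntegral_indicator hB0, ← setIntegral_condExp h₁ (hfi.indicator hB0) hA,
    setIntegral_congr_ae (g := fun _ => ∫ ω, B.indicator f ω ∂P) (h₁ A hA)]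
  · rw [setIntegral_const, integral_indicator hB0, smul_eq_mul]
  · filter_upwards [condExp_indep_eq h₂ h₁ (hf.indicator hB) hind] with ω h _
    exact h

/-- Since m₁ is independent of everything that determines f and m₂, it adds no information. On the
π-system of sets A ∩ B both integrals factor as P(A) times an integral over B. -/
theorem condExp_sup_of_indep {Ω : Type*} {m₁ m₂ m₃ m0 : MeasurableSpace Ω} {P : Measure Ω}
    [IsProbabilityMeasure P] (h₁ : m₁ ≤ m0) (h₃ : m₃ ≤ m0) (h₂₃ : m₂ ≤ m₃)
    (hind : Indep m₃ m₁ P) {f : Ω → ℝ} (hf : StronglyMeasurable[m₃] f) (hfi : Integrable f P) :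
    P[f | m₁ ⊔ m₂] =ᵐ[P] P[f | m₂] := by
  have h₂ : m₂ ≤ m0 := h₂₃.trans h₃
  have hs : m₁ ⊔ m₂ ≤ m0 := sup_le h₁ h₂
  symm
  refine ae_eq_condExp_of_forall_setIntegral_eq hs hfi
    (fun s _ _ => integrable_condExp.integrableOn) (fun s hsm _ => ?_)
    (stronglyMeasurable_condExp.mono (le_sup_right : m₂ ≤ m₁ ⊔ m₂)).aestronglyMeasurable
  induction s, hsm using MeasurableSpace.induction_on_inter (generateFrom_inter_eq_sup m₁ m₂)
    (isPiSystem_inter_measurableSet m₁ m₂) with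
  | empty => simp
  | basic t ht =>
    obtain ⟨A, B, hA, hB, rfl⟩ := ht
    rw [setIntegral_inter_of_indep h₁ h₃ hind hf hfi hA (h₂₃ B hB),
      setIntegral_inter_of_indep h₁ h₃ hind (stronglyMeasurable_condExp.mono h₂₃)
        integrable_condExp hA (h₂₃ B hB), setIntegral_condExp h₂ hfi hB]
  | compl t ht ih =>
    have ih := ih (measure_lt_top _ _)
    rw [setIntegral_compl (hs t ht) integrable_condExp, setIntegral_compl (hs t ht) hfi, ih,
      integral_condExp h₂]
  | iUnion s hd hsm ih =>
    rw [integral_iUnion (fun i => hs _ (hsm i)) hd integrable_condExp.integrableOn,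
      integral_iUnion (fun i => hs _ (hsm i)) hd hfi.integrableOn]
    exact tsum_congr fun i => ih i (measure_lt_top _ _)

/-- The σ-algebra generated by the members of a family with index in a given set. -/
@[reducible]
def sigmaOf {Ω ι : Type*} (Y : ι → Ω → ℝ) (S : Set ι) : MeasurableSpace Ω :=
  ⨆ i ∈ S, MeasurableSpace.comap (Y i) inferInstance

section SigmaOf

variable {Ω ι : Type*} {Y : ι → Ω → ℝ}

theorem measurable_sigmaOf {S : Set ι} {i : ι} (hi : i ∈ S) : Measurable[sigmaOf Y S] (Y i) :=
  Measurable.mono (comap_measurable (Y i))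
    (le_iSup₂_of_le (f := fun i (_ : i ∈ S) => MeasurableSpace.comap (Y i) inferInstance)
      i hi le_rfl) le_rfl

theorem sigmaOf_le_iff {S : Set ι} {m : MeasurableSpace Ω} :
    sigmaOf Y S ≤ m ↔ ∀ i ∈ S, Measurable[m] (Y i) := by
  simp only [sigmaOf, iSup_le_iff, measurable_iff_comap_le]

theorem sigmaOf_mono {S T : Set ι} (h : S ⊆ T) : sigmaOf Y S ≤ sigmaOf Y T :=
  sigmaOf_le_iff.mpr fun _ hi => measurable_sigmaOf (h hi)

theorem indep_sigmaOf [MeasurableSpace Ω] {P : Measure Ω} (hY : ∀ i, Measurable (Y i))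
    (h : iIndepFun Y P) {S T : Set ι} (hST : Disjoint S T) :
    Indep (sigmaOf Y S) (sigmaOf Y T) P :=
  indep_iSup_of_disjoint (fun i => (hY i).comap_le) h hST

end SigmaOf

/-! ### Innovations, equality in law under replacement, and projections on the future. -/

namespace LocStat

section Sequences

variable {Ω : Type*} {ε ε' : ℤ → Ω → ℝ}

/-- The σ-algebra generated by the innovations from time `l` on. -/
@[reducible]
def future (ε : ℤ → Ω → ℝ) (l : ℤ) : MeasurableSpace Ω := sigmaOf ε (Set.Ici l)

/-- The two-sided sequence of innovations with the entry at time `l` replaced by its copy. -/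
def replaceAt (ε ε' : ℤ → Ω → ℝ) (l : ℤ) (ω : Ω) : ℤ → ℝ :=
  fun i => if i = l then ε' i ω else ε i ω

theorem future_mono {l l' : ℤ} (h : l ≤ l') : future ε l' ≤ future ε l :=
  sigmaOf_mono (Set.Ici_subset_Ici.mpr h)

theorem future_eq_sup (ε : ℤ → Ω → ℝ) (l : ℤ) :
    future ε l = sigmaOf ε {l} ⊔ future ε (l + 1) := by
  apply le_antisymm
  · refine sigmaOf_le_iff.mpr fun i hi => ?_
    rcases (show l ≤ i from hi).eq_or_lt with rfl | h
    · exact (measurable_sigmaOf (Set.mem_singleton l)).mono le_sup_left le_rfl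
    · have h' : i ∈ Set.Ici (l + 1) := by simpa using h
      exact (measurable_sigmaOf h').mono le_sup_right le_rfl
  · exact sup_le (sigmaOf_mono (by simp)) (future_mono (by omega))

theorem sigmaOf_eq_sigmaOf_elim (S : Set ℤ) :
    sigmaOf ε S = sigmaOf (Sum.elim ε ε') (Sum.inl '' S) := by
  apply le_antisymm
  · exact sigmaOf_le_iff.mpr fun i hi =>
      measurable_sigmaOf (Y := Sum.elim ε ε') (Set.mem_image_of_mem Sum.inl hi)
  · refine sigmaOf_le_iff.mpr ?_
    rintro _ ⟨i, hi, rfl⟩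
    exact measurable_sigmaOf (Y := ε) hi

theorem pastReplace_eq (t : ℤ) (j : ℕ) (ω : Ω) :
    pastReplace ε ε' t j ω = fun n : ℕ => replaceAt ε ε' (t - j) ω (t - n) := by
  funext n
  unfold pastReplace replaceAt
  have : (t - (n : ℤ) = t - j) ↔ n = j := by omega
  simp only [this]

/-- Writes an event as a condition on the path, so that equality in law can transport it. -/
theorem exists_preimage_of_measurableSet_future {l : ℤ} {B : Set Ω}
    (hB : MeasurableSet[future ε l] B) :
    ∃ B' : Set (ℕ → ℝ), MeasurableSet B' ∧ (fun ω (n : ℕ) => ε (l + n) ω) ⁻¹' B' = B := by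
  have h : future ε l ≤ MeasurableSpace.comap (fun ω (n : ℕ) => ε (l + n) ω) inferInstance := by
    refine sigmaOf_le_iff.mpr fun i hi => ?_
    obtain ⟨n, hn⟩ := Int.eq_ofNat_of_zero_le (sub_nonneg.mpr (show l ≤ i from hi))
    have e : ε i = (fun w : ℕ → ℝ => w n) ∘ (fun ω (n : ℕ) => ε (l + n) ω) := by
      funext ω
      simp only [Function.comp]
      congr
      omega
    rw [e]
    exact (measurable_pi_apply n).comp (comap_measurable _)
  exact h B hB

theorem stronglyMeasurable_comp_seq {m : MeasurableSpace Ω} {g : (ℕ → ℝ) → ℝ}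
    (hg : Measurable g) {w : Ω → ℕ → ℝ} (hw : ∀ n, Measurable[m] fun ω => w ω n) :
    StronglyMeasurable[m] fun ω => g (w ω) :=
  (hg.comp (measurable_pi_lambda _ hw)).stronglyMeasurable

end Sequences

variable {Ω : Type*} [m0 : MeasurableSpace Ω] {P : Measure Ω} {ε ε' : ℤ → Ω → ℝ}

theorem IIDWithCopy.measurable_elim (hε : IIDWithCopy P ε ε') (i : ℤ ⊕ ℤ) :
    Measurable (Sum.elim ε ε' i) := by
  cases i with
  | inl i => exact hε.measurable i
  | inr i => exact hε.measurable_copy i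

theorem IIDWithCopy.future_le (hε : IIDWithCopy P ε ε') (l : ℤ) : future ε l ≤ m0 :=
  sigmaOf_le_iff.mpr fun i _ => hε.measurable i

theorem IIDWithCopy.measurable_past (hε : IIDWithCopy P ε ε') (t : ℤ) : Measurable (past ε t) :=
  measurable_pi_lambda _ fun _ => hε.measurable _

/-- Every injective selection from the i.i.d. family has the same product law; stationarity and the
replacement couplings are instances. -/
theorem IIDWithCopy.map_comp_injective (hε : IIDWithCopy P ε ε') {κ : Type*} {φ : κ → ℤ ⊕ ℤ}
    (hφ : Function.Injective φ) :
    P.map (fun ω k => Sum.elim ε ε' (φ k) ω) = Measure.infinitePi (fun _ : κ => P.map (ε 0)) := by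
  have h := (hε.indep.precomp hφ).map_fun_eq_infinitePi_map fun i => hε.measurable_elim (φ i)
  rw [h]
  congr 1
  funext k
  cases hk : φ k with
  | inl i => simpa [hk] using (hε.ident i).map_eq
  | inr i => simpa [hk] using (hε.ident_copy i).map_eq

theorem IIDWithCopy.identDistrib_comp (hε : IIDWithCopy P ε ε') {κ : Type*} {φ ψ : κ → ℤ ⊕ ℤ}
    (hφ : Function.Injective φ) (hψ : Function.Injective ψ) :
    IdentDistrib (fun ω k => Sum.elim ε ε' (φ k) ω) (fun ω k => Sum.elim ε ε' (ψ k) ω) P P where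
  aemeasurable_fst := (measurable_pi_lambda _ fun k => hε.measurable_elim (φ k)).aemeasurable
  aemeasurable_snd := (measurable_pi_lambda _ fun k => hε.measurable_elim (ψ k)).aemeasurable
  map_eq := by rw [hε.map_comp_injective hφ, hε.map_comp_injective hψ]

theorem IIDWithCopy.identDistrib_past (hε : IIDWithCopy P ε ε') (s t : ℤ) :
    IdentDistrib (past ε s) (past ε t) P P :=
  hε.identDistrib_comp (φ := fun n : ℕ => Sum.inl (s - n)) (ψ := fun n : ℕ => Sum.inl (t - n))
    (fun a b h => by simpa using h) (fun a b h => by simpa using h)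

theorem IIDWithCopy.identDistrib_replaceAt (hε : IIDWithCopy P ε ε') (l : ℤ) :
    IdentDistrib (fun ω i => ε i ω) (replaceAt ε ε' l) P P := by
  have h := hε.identDistrib_comp (φ := fun i : ℤ => Sum.inl i)
    (ψ := fun i : ℤ => if i = l then Sum.inr i else Sum.inl i) (fun a b h => by simpa using h)
    (fun a b h => by
      simp only at h
      split_ifs at h <;> simp_all)
  have e : replaceAt ε ε' l =
      fun ω i => Sum.elim ε ε' (if i = l then Sum.inr i else Sum.inl i) ω := by
    funext ω i
    unfold replaceAt
    split_ifs <;> rfl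
  rw [e]
  exact h

theorem IIDWithCopy.identDistrib_pastReplace (hε : IIDWithCopy P ε ε') (t : ℤ) (j : ℕ) :
    IdentDistrib (past ε t) (pastReplace ε ε' t j) P P := by
  have h := (hε.identDistrib_replaceAt (t - j)).comp
    (u := fun (w : ℤ → ℝ) (n : ℕ) => w (t - n))
    (measurable_pi_lambda _ fun n => measurable_pi_apply _)
  convert! h using 1
  funext ω
  exact pastReplace_eq t j ω

/-- The event B involves only innovations after time t - j, which the replacement leaves alone. Both
integrals are therefore the mean of one functional `F`, evaluated at two sequences of the same law.
-/
theorem IIDWithCopy.setIntegral_pastReplace (hε : IIDWithCopy P ε ε') {g : (ℕ → ℝ) → ℝ}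
    (hg : Measurable g) (t : ℤ) (j : ℕ) {B : Set Ω}
    (hB : MeasurableSet[future ε (t - j + 1)] B) :
    ∫ ω in B, g (pastReplace ε ε' t j ω) ∂P = ∫ ω in B, g (past ε t ω) ∂P := by
  have hB0 := hε.future_le _ B hB
  obtain ⟨B', hB', rfl⟩ := exists_preimage_of_measurableSet_future hB
  set F : (ℤ → ℝ) → ℝ := fun w =>
    ((fun (v : ℤ → ℝ) (n : ℕ) => v (t - j + 1 + n)) ⁻¹' B').indicator
      (fun v => g fun n : ℕ => v (t - n)) w with hF
  have hFm : Measurable F := by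
    refine Measurable.indicator ?_ ?_
    · exact hg.comp (measurable_pi_lambda _ fun n => measurable_pi_apply _)
    · exact (measurable_pi_lambda _ fun n => measurable_pi_apply _) hB'
  have h := ((hε.identDistrib_replaceAt (t - j)).comp hFm).integral_eq
  rw [← integral_indicator hB0, ← integral_indicator hB0]
  symm
  convert! h using 2
  funext ω
  have e : (fun n : ℕ => replaceAt ε ε' (t - j) ω (t - j + 1 + n)) =
      fun n : ℕ => ε (t - j + 1 + n) ω := by
    funext n
    unfold replaceAt
    rw [if_neg (by omega)]
  have e' : replaceAt ε ε' (t - j) ω ∈ (fun (v : ℤ → ℝ) (n : ℕ) => v (t - j + 1 + n)) ⁻¹' B' ↔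
      ω ∈ (fun ω (n : ℕ) => ε (t - j + 1 + n) ω) ⁻¹' B' := by
    rw [Set.mem_preimage, e, Set.mem_preimage]
  simp only [Function.comp, hF]
  by_cases hω : ω ∈ (fun ω (n : ℕ) => ε (t - j + 1 + n) ω) ⁻¹' B'
  · rw [Set.indicator_of_mem hω, Set.indicator_of_mem (e'.mpr hω), pastReplace_eq]
  · rw [Set.indicator_of_notMem hω, Set.indicator_of_notMem (mt e'.mp hω)]

variable [IsProbabilityMeasure P]

/-- The replaced sequence does not contain ε_{t-j}, so conditioning on that variable is vacuous. On
the remaining future the original and the replaced sequence have the same integrals. -/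
theorem IIDWithCopy.condExp_pastReplace (hε : IIDWithCopy P ε ε') {g : (ℕ → ℝ) → ℝ}
    (hg : Measurable g) (t : ℤ) (j : ℕ) (hgi : Integrable (fun ω => g (past ε t ω)) P) :
    P[fun ω => g (pastReplace ε ε' t j ω) | future ε (t - j)] =ᵐ[P]
      P[fun ω => g (past ε t ω) | future ε (t - j + 1)] := by
  have hgi' : Integrable (fun ω => g (pastReplace ε ε' t j ω)) P :=
    ((hε.identDistrib_pastReplace t j).comp hg).integrable_iff.mp hgi
  have h1 : P[fun ω => g (pastReplace ε ε' t j ω) | future ε (t - j)] =ᵐ[P]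
      P[fun ω => g (pastReplace ε ε' t j ω) | future ε (t - j + 1)] := by
    set l := t - j with hl
    rw [future_eq_sup ε l, sigmaOf_eq_sigmaOf_elim (ε' := ε') {l}]
    -- `m₃` is generated by all innovations and copies except ε_l.
    refine condExp_sup_of_indep (m₃ := sigmaOf (Sum.elim ε ε') (Sum.inl '' {l})ᶜ)
      (sigmaOf_le_iff.mpr fun i _ => hε.measurable_elim i)
      (sigmaOf_le_iff.mpr fun i _ => hε.measurable_elim i) ?_
      (indep_sigmaOf hε.measurable_elim hε.indep disjoint_compl_left) ?_ hgi'
    · rw [future, sigmaOf_eq_sigmaOf_elim (ε' := ε')]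
      refine sigmaOf_mono ?_
      rintro _ ⟨i, hi, rfl⟩
      have : l + 1 ≤ i := hi
      simp
      omega
    · refine stronglyMeasurable_comp_seq hg fun n => ?_
      unfold pastReplace
      split_ifs with h
      · exact measurable_sigmaOf (Y := Sum.elim ε ε') (i := Sum.inr (t - n)) (by simp)
      · exact measurable_sigmaOf (Y := Sum.elim ε ε') (i := Sum.inl (t - n)) (by
          simp
          omega)
  refine h1.trans ?_
  symm
  have hle := hε.future_le (t - j + 1)
  refine ae_eq_condExp_of_forall_setIntegral_eq hle hgi'
    (fun s _ _ => integrable_condExp.integrableOn) (fun s hs _ => ?_)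
    stronglyMeasurable_condExp.aestronglyMeasurable
  rw [setIntegral_condExp hle hgi hs, hε.setIntegral_pastReplace hg t j hs]

/-- The difference of projections is a single conditional expectation of the coupling difference,
and conditional expectation contracts L_p. -/
theorem IIDWithCopy.eLpNorm_condExp_future_sub_le (hε : IIDWithCopy P ε ε') {g : (ℕ → ℝ) → ℝ}
    (hg : Measurable g) (t : ℤ) (j : ℕ) (hgi : Integrable (fun ω => g (past ε t ω)) P)
    {p : ℝ≥0∞} (hp : 1 ≤ p) :
    eLpNorm (P[fun ω => g (past ε t ω) | future ε (t - j)] -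
        P[fun ω => g (past ε t ω) | future ε (t - j + 1)]) p P ≤
      eLpNorm (fun ω => g (past ε t ω) - g (pastReplace ε ε' t j ω)) p P := by
  have hgi' : Integrable (fun ω => g (pastReplace ε ε' t j ω)) P :=
    ((hε.identDistrib_pastReplace t j).comp hg).integrable_iff.mp hgi
  refine le_trans (le_of_eq (eLpNorm_congr_ae ?_)) (eLpNorm_condExp_le_eLpNorm
    (m := future ε (t - j)) (fun ω => g (past ε t ω) - g (pastReplace ε ε' t j ω)) hp)
  filter_upwards [hε.condExp_pastReplace hg t j hgi, condExp_sub hgi hgi' (future ε (t - j))]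
    with ω h1 h2
  have h3 : (P[fun ω => g (past ε t ω) - g (pastReplace ε ε' t j ω) | future ε (t - j)]) ω =
    (P[(fun ω => g (past ε t ω)) - fun ω => g (pastReplace ε ε' t j ω) | future ε (t - j)]) ω := rfl
  rw [h3, h2, Pi.sub_apply, Pi.sub_apply, h1]

theorem IIDWithCopy.condExp_past_future (hε : IIDWithCopy P ε ε') {g : (ℕ → ℝ) → ℝ}
    (hg : Measurable g) (t : ℤ) :
    P[fun ω => g (past ε t ω) | future ε (t + 1)] =ᵐ[P] fun _ => ∫ ω, g (past ε t ω) ∂P := by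
  have hle : ∀ S : Set (ℤ ⊕ ℤ), sigmaOf (Sum.elim ε ε') S ≤ m0 := fun S =>
    sigmaOf_le_iff.mpr fun i _ => hε.measurable_elim i
  rw [future, sigmaOf_eq_sigmaOf_elim (ε' := ε')]
  refine condExp_indep_eq (m₁ := sigmaOf (Sum.elim ε ε') (Sum.inl '' Set.Ici (t + 1))ᶜ)
    (hle _) (hle _) ?_ (indep_sigmaOf hε.measurable_elim hε.indep disjoint_compl_left)
  refine stronglyMeasurable_comp_seq hg fun n => ?_
  exact measurable_sigmaOf (Y := Sum.elim ε ε') (i := Sum.inl (t - n)) (by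
    simp)

/-- Lévy's upward theorem: the entry ε_{t-n} is known from depth n + 1 on. -/
theorem IIDWithCopy.tendsto_condExp_future (hε : IIDWithCopy P ε ε') {g : (ℕ → ℝ) → ℝ}
    (hg : Measurable g) (t : ℤ) (hgi : Integrable (fun ω => g (past ε t ω)) P) :
    ∀ᵐ ω ∂P, Tendsto (fun J : ℕ => (P[fun ω => g (past ε t ω) | future ε (t + 1 - J)]) ω) atTop
      (𝓝 (g (past ε t ω))) := by
  let ℱ : Filtration ℕ m0 :=
    { seq := fun J => future ε (t + 1 - J)
      mono' := fun a b h => future_mono (by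
        have : (a : ℤ) ≤ b := by exact_mod_cast h
        omega)
      le' := fun J => hε.future_le _ }
  refine hgi.tendsto_ae_condExp (ℱ := ℱ) ?_
  refine stronglyMeasurable_comp_seq hg fun n => ?_
  refine Measurable.mono (measurable_sigmaOf (Y := ε) (S := Set.Ici (t + 1 - ((n + 1 : ℕ) : ℤ)))
    (i := t - n) ?_) (le_iSup (fun J => ℱ J) (n + 1)) le_rfl
  simp

end LocStat

/-! ### Moments of sums of weakly dependent variables. -/

theorem one_le_ofReal {q : ℝ} (hq : 1 ≤ q) : (1 : ℝ≥0∞) ≤ ENNReal.ofReal q := by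
  rw [← ENNReal.ofReal_one]; exact ENNReal.ofReal_le_ofReal hq

theorem eLpNorm_le_ofReal_iff {Ω E : Type*} [MeasurableSpace Ω] [NormedAddCommGroup E]
    {P : Measure Ω} {q : ℝ} (hq : 0 < q) {f : Ω → E} (hf : MemLp f (ENNReal.ofReal q) P) {c : ℝ}
    (hc : 0 ≤ c) :
    eLpNorm f (ENNReal.ofReal q) P ≤ ENNReal.ofReal c ↔ ∫ ω, ‖f ω‖ ^ q ∂P ≤ c ^ q := by
  have h0 : 0 ≤ ∫ ω, ‖f ω‖ ^ q ∂P := integral_nonneg fun ω => by positivity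
  rw [hf.eLpNorm_eq_integral_rpow_norm (by simpa using hq) ENNReal.ofReal_ne_top,
    ENNReal.ofReal_le_ofReal_iff hc, ENNReal.toReal_ofReal hq.le]
  exact Real.rpow_inv_le_iff_of_pos h0 hc hq

namespace LocStat

variable {Ω : Type*} [m0 : MeasurableSpace Ω] {P : Measure Ω} [IsProbabilityMeasure P]
  {ε ε' : ℤ → Ω → ℝ}

/-- At fixed depth j the increments are martingale differences in r, for the filtration that grows
as time runs backwards. The constant K enters as a hypothesis so that it is the same for all j. -/
theorem IIDWithCopy.condExp_increment_sum_le (hε : IIDWithCopy P ε ε') {q ρ B K : ℝ} (hq : 2 < q)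
    (hρ : 0 ≤ ρ) (hB : 0 ≤ B) (hK : 0 < K)
    (hKP : ∀ (𝒢 : ℕ → MeasurableSpace Ω) (D : ℕ → Ω → ℝ) (M : ℝ),
      Monotone 𝒢 → (∀ i, 𝒢 i ≤ m0) → (∀ i, StronglyMeasurable[𝒢 (i + 1)] (D i)) →
      (∀ i, MemLp (D i) (ENNReal.ofReal q) P) → (∀ i, P[D i | 𝒢 i] =ᵐ[P] 0) →
      (∀ i, ∫ ω, |D i ω| ^ q ∂P ≤ M) → ∀ n : ℕ,
      ∫ ω, |∑ i ∈ Finset.range n, D i ω| ^ q ∂P ≤ K * (n : ℝ) ^ (q / 2) * M)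
    {g : ℕ → (ℕ → ℝ) → ℝ} (hg : ∀ r, Measurable (g r)) (T : ℤ)
    (hgq : ∀ r : ℕ, MemLp (fun ω => g r (past ε (T - r) ω)) (ENNReal.ofReal q) P) (j : ℕ)
    (hgj : ∀ r : ℕ, eLpNorm (fun ω => g r (past ε (T - r) ω) -
      g r (pastReplace ε ε' (T - r) j ω)) (ENNReal.ofReal q) P ≤ ENNReal.ofReal (B * ρ ^ j))
    (N : ℕ) :
    eLpNorm (fun ω => ∑ r ∈ Finset.range N,
      ((P[fun ω => g r (past ε (T - r) ω) | future ε (T - r + 1 - (j + 1 : ℕ))]) ω -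
        (P[fun ω => g r (past ε (T - r) ω) | future ε (T - r + 1 - j)]) ω)) (ENNReal.ofReal q) P
      ≤ ENNReal.ofReal (K ^ q⁻¹ * √N * B * ρ ^ j) := by
  have hq0 : 0 < q := by linarith
  have h1q : (1 : ℝ≥0∞) ≤ ENNReal.ofReal q := one_le_ofReal (by linarith)
  have hgi : ∀ r : ℕ, Integrable (fun ω => g r (past ε (T - r) ω)) P :=
    fun r => (hgq r).integrable h1q
  set D : ℕ → Ω → ℝ := fun r =>
    P[fun ω => g r (past ε (T - r) ω) | future ε (T - r + 1 - (j + 1 : ℕ))] -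
      P[fun ω => g r (past ε (T - r) ω) | future ε (T - r + 1 - j)] with hD
  have hle : ∀ r : ℕ, future ε (T - r + 1 - j) ≤ future ε (T - r + 1 - (j + 1 : ℕ)) :=
    fun r => future_mono (by push_cast; omega)
  have hDq : ∀ r, MemLp (D r) (ENNReal.ofReal q) P := fun r =>
    ((hgq r).condExp h1q).sub ((hgq r).condExp h1q)
  have hBj : 0 ≤ B * ρ ^ j := by positivity
  have hmain := hKP (fun r => future ε (T - r + 1 - j)) D ((B * ρ ^ j) ^ q)
    (fun a b h => future_mono (by
      have : (a : ℤ) ≤ b := by exact_mod_cast h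
      omega))
    (fun r => hε.future_le _) (fun r => ?_) hDq (fun r => ?_) (fun r => ?_) N
  · have hs : MemLp (fun ω => ∑ r ∈ Finset.range N, D r ω) (ENNReal.ofReal q) P :=
      memLp_finsetSum _ fun r _ => hDq r
    refine (eLpNorm_le_ofReal_iff hq0 hs (by positivity)).mpr (hmain.trans (le_of_eq ?_))
    have e : (K ^ q⁻¹ * √N) ^ q = K * (N : ℝ) ^ (q / 2) := by
      rw [Real.mul_rpow (by positivity) (by positivity), Real.rpow_inv_rpow hK.le hq0.ne',
        Real.sqrt_eq_rpow, ← Real.rpow_mul (by positivity)]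
      congr 2
      ring
    rw [mul_assoc (K ^ q⁻¹ * √N), Real.mul_rpow (by positivity) hBj, e]
  -- Depth j at summand r + 1 and depth j + 1 at summand r reach back to the same innovation; this
  -- makes the increments adapted.
  · have e : T - ((r + 1 : ℕ) : ℤ) + 1 - j = T - r + 1 - (j + 1 : ℕ) := by push_cast; ring
    rw [e]
    exact stronglyMeasurable_condExp.sub (stronglyMeasurable_condExp.mono (hle r))
  · have h1 := condExp_sub (m := future ε (T - r + 1 - j))
      (integrable_condExp (μ := P) (f := fun ω => g r (past ε (T - r) ω))
        (m := future ε (T - r + 1 - (j + 1 : ℕ))))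
      (integrable_condExp (μ := P) (f := fun ω => g r (past ε (T - r) ω))
        (m := future ε (T - r + 1 - j)))
    have h2 := condExp_condExp_of_le (μ := P) (f := fun ω => g r (past ε (T - r) ω)) (hle r)
      (hε.future_le _)
    have h3 := condExp_condExp_of_le (μ := P) (f := fun ω => g r (past ε (T - r) ω))
      (le_refl (future ε (T - r + 1 - j))) (hε.future_le _)
    filter_upwards [h1, h2, h3] with ω h1 h2 h3
    rw [h1, Pi.sub_apply, h2, h3, sub_self]
    rfl
  · refine (eLpNorm_le_ofReal_iff hq0 (hDq r) hBj).mp (le_trans ?_ (hgj r))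
    have h := hε.eLpNorm_condExp_future_sub_le (hg r) (T - r) j (hgi r) h1q
    have e1 : T - r + 1 - ((j + 1 : ℕ) : ℤ) = T - r - j := by push_cast; ring
    have e2 : T - (r : ℤ) + 1 - j = T - r - j + 1 := by ring
    simp only [hD]
    rw [e1, e2]
    exact h

/-- Telescope every summand over the depth, exchange the two sums, and apply Minkowski over the
depth; ∑ ρ^j gives the factor (1 - ρ)⁻¹. -/
theorem IIDWithCopy.exists_sum_moment_bound (hε : IIDWithCopy P ε ε') {q ρ : ℝ} (hq : 2 < q)
    (hρ : 0 ≤ ρ) (hρ1 : ρ < 1) :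
    ∃ K : ℝ, 0 < K ∧ ∀ (g : ℕ → (ℕ → ℝ) → ℝ) (B : ℝ) (T : ℤ), (∀ r, Measurable (g r)) → 0 ≤ B →
      (∀ r : ℕ, MemLp (fun ω => g r (past ε (T - r) ω)) (ENNReal.ofReal q) P) →
      (∀ r j : ℕ, eLpNorm (fun ω => g r (past ε (T - r) ω) -
        g r (pastReplace ε ε' (T - r) j ω)) (ENNReal.ofReal q) P ≤ ENNReal.ofReal (B * ρ ^ j)) →
      ∀ N : ℕ, eLpNorm (fun ω => ∑ r ∈ Finset.range N,
          (g r (past ε (T - r) ω) - ∫ ω, g r (past ε (T - r) ω) ∂P)) (ENNReal.ofReal q) P ≤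
        ENNReal.ofReal (K * B * √N) := by
  obtain ⟨K, hK, hKP⟩ := exists_martingale_rpow_moment_bound P hq.le
  have hρ' : 0 < 1 - ρ := by linarith
  refine ⟨K ^ q⁻¹ * (1 - ρ)⁻¹, by positivity, fun g B T hg hB hgq hgj N => ?_⟩
  have h1q : (1 : ℝ≥0∞) ≤ ENNReal.ofReal q := one_le_ofReal (by linarith)
  have hgi : ∀ r : ℕ, Integrable (fun ω => g r (past ε (T - r) ω)) P :=
    fun r => (hgq r).integrable h1q
  set a : ℕ → ℕ → Ω → ℝ := fun r J =>
    P[fun ω => g r (past ε (T - r) ω) | future ε (T - r + 1 - J)] with ha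
  have haq : ∀ r J, MemLp (a r J) (ENNReal.ofReal q) P := fun r J => (hgq r).condExp h1q
  have ha0 : ∀ r, a r 0 =ᵐ[P] fun _ => ∫ ω, g r (past ε (T - r) ω) ∂P := fun r => by
    have := hε.condExp_past_future (hg r) (T - r)
    simpa [ha] using this
  -- Fatou: it suffices to bound the sums truncated at depth J uniformly in J. Depth 0 is the mean,
  -- because the future beyond t is independent of the past.
  refine (Lp.eLpNorm_lim_le_liminf_eLpNorm
    (f := fun J ω => ∑ r ∈ Finset.range N, (a r J ω - a r 0 ω)) (fun J =>
      (memLp_finsetSum _ fun r _ => (haq r J).sub (haq r 0)).1) _ ?_).trans ?_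
  · have h1 : ∀ᵐ ω ∂P, ∀ r, Tendsto (fun J => a r J ω) atTop (𝓝 (g r (past ε (T - r) ω))) :=
      ae_all_iff.mpr fun r => hε.tendsto_condExp_future (hg r) (T - r) (hgi r)
    filter_upwards [h1, ae_all_iff.mpr ha0] with ω h1 h2
    refine tendsto_finsetSum _ fun r _ => ?_
    rw [← h2 r]
    exact (h1 r).sub_const _
  · refine liminf_le_of_le (by isBoundedDefault) fun b hb => ?_
    obtain ⟨J, hJ⟩ := hb.exists
    refine hJ.trans ?_
    have e : (fun ω => ∑ r ∈ Finset.range N, (a r J ω - a r 0 ω)) =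
        fun ω => ∑ j ∈ Finset.range J, ∑ r ∈ Finset.range N, (a r (j + 1) ω - a r j ω) := by
      funext ω
      rw [Finset.sum_comm]
      exact Finset.sum_congr rfl fun r _ => (Finset.sum_range_sub (fun j => a r j ω) J).symm
    rw [e]
    have e' : (fun ω => ∑ j ∈ Finset.range J, ∑ r ∈ Finset.range N, (a r (j + 1) ω - a r j ω)) =
        ∑ j ∈ Finset.range J, fun ω => ∑ r ∈ Finset.range N, (a r (j + 1) ω - a r j ω) := by
      funext ω; simp
    rw [e']
    refine (eLpNorm_sum_le (fun j _ =>
      (memLp_finsetSum _ fun r _ => (haq r (j + 1)).sub (haq r j)).1) h1q).trans ?_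
    refine (Finset.sum_le_sum fun j _ => hε.condExp_increment_sum_le hq hρ hB hK hKP hg T hgq j
      (fun r => hgj r j) N).trans ?_
    rw [← ENNReal.ofReal_sum_of_nonneg fun j _ => by positivity, ← Finset.mul_sum]
    refine ENNReal.ofReal_le_ofReal ?_
    have hgeom : ∑ j ∈ Finset.range J, ρ ^ j ≤ (1 - ρ)⁻¹ :=
      (Summable.sum_le_tsum _ (fun j _ => by positivity)
        (summable_geometric_of_lt_one hρ hρ1)).trans (tsum_geometric_of_lt_one hρ hρ1).le
    calc K ^ q⁻¹ * √N * B * ∑ j ∈ Finset.range J, ρ ^ j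
        ≤ K ^ q⁻¹ * √N * B * (1 - ρ)⁻¹ := by gcongr
      _ = _ := by ring

end LocStat

/-! ### The stochastic error of the local average. -/

namespace LocStat

variable {Ω : Type*} [m0 : MeasurableSpace Ω] {P : Measure Ω} {ε ε' : ℤ → Ω → ℝ} {d : ℕ}
  {G : ℕ → ℝ → (ℕ → ℝ) → EuclideanSpace ℝ (Fin d)} {q CG ρ : ℝ}

/-- The expectation of `localAverage`. -/
noncomputable def meanAverage (μ : ℝ → EuclideanSpace ℝ (Fin d)) (k n t : ℕ) :
    EuclideanSpace ℝ (Fin d) :=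
  ((min k t : ℕ) : ℝ)⁻¹ • ∑ i ∈ Finset.Icc (max (t - k) 1) t, μ ((i : ℝ) / n)

theorem IIDWithCopy.eLpNorm_past (hε : IIDWithCopy P ε ε') {H : (ℕ → ℝ) → EuclideanSpace ℝ (Fin d)}
    (hH : Measurable H) (s t : ℤ) (p : ℝ≥0∞) :
    eLpNorm (fun ω => H (past ε s ω)) p P = eLpNorm (fun ω => H (past ε t ω)) p P :=
  ((hε.identDistrib_past s t).comp hH).eLpNorm_eq p

theorem IIDWithCopy.integral_past (hε : IIDWithCopy P ε ε') {H : (ℕ → ℝ) → EuclideanSpace ℝ (Fin d)}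
    (hH : Measurable H) (s t : ℤ) :
    ∫ ω, H (past ε s ω) ∂P = ∫ ω, H (past ε t ω) ∂P :=
  ((hε.identDistrib_past s t).comp hH).integral_eq

theorem IIDWithCopy.memLp_past (hε : IIDWithCopy P ε ε') (hG : ∀ n u, Measurable (G n u))
    (hmom : UniformlyBoundedMoments P ε G q CG) {n : ℕ} (hn : 1 ≤ n) {u : ℝ}
    (hu : u ∈ Set.Icc (0 : ℝ) 1) (t : ℤ) :
    MemLp (fun ω => G n u (past ε t ω)) (ENNReal.ofReal q) P := by
  refine ⟨((hG n u).comp (hε.measurable_past t)).aestronglyMeasurable, ?_⟩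
  rw [hε.eLpNorm_past (hG n u) t 0]
  exact (hmom n hn u hu).trans_lt ENNReal.ofReal_lt_top

theorem eLpNorm_le_sum_coord {f : Ω → EuclideanSpace ℝ (Fin d)} (hf : AEStronglyMeasurable f P)
    {p : ℝ≥0∞} (hp : 1 ≤ p) :
    eLpNorm f p P ≤ ∑ c, eLpNorm (fun ω => f ω c) p P := by
  have hc : ∀ c, AEStronglyMeasurable (fun ω => f ω c) P := fun c =>
    (EuclideanSpace.proj c : EuclideanSpace ℝ (Fin d) →L[ℝ] ℝ).continuous.comp_aestronglyMeasurable
      hf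
  calc eLpNorm f p P ≤ eLpNorm (∑ c, fun ω => ‖f ω c‖) p P := by
        refine eLpNorm_mono_real fun ω => ?_
        rw [Finset.sum_apply]
        rw [EuclideanSpace.norm_eq]
        refine Real.sqrt_le_iff.mpr ⟨Finset.sum_nonneg fun c _ => norm_nonneg _, ?_⟩
        exact Finset.sum_sq_le_sq_sum_of_nonneg fun c _ => norm_nonneg _
    _ ≤ ∑ c, eLpNorm (fun ω => ‖f ω c‖) p P := eLpNorm_sum_le (fun c _ => (hc c).norm) hp
    _ = _ := Finset.sum_congr rfl fun c _ => eLpNorm_norm _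

theorem natCast_div_mem_Icc {i n : ℕ} (h : i ≤ n) : (i : ℝ) / n ∈ Set.Icc (0 : ℝ) 1 :=
  ⟨by positivity, div_le_one_of_le₀ (by exact_mod_cast h) (by positivity)⟩

theorem sum_Icc_eq_sum_range_sub {M : Type*} [AddCommMonoid M] (F : ℕ → M) {s t : ℕ} :
    ∑ i ∈ Finset.Icc s t, F i = ∑ r ∈ Finset.range (t + 1 - s), F (t - r) := by
  refine Finset.sum_nbij' (fun i => t - i) (fun r => t - r) ?_ ?_ ?_ ?_ ?_ <;>
    simp only [Finset.mem_Icc, Finset.mem_range] <;> intro i hi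
  · omega
  · omega
  · omega
  · omega
  · congr
    omega

theorem IIDWithCopy.memLp_localAverage (hε : IIDWithCopy P ε ε') (hG : ∀ n u, Measurable (G n u))
    (hmom : UniformlyBoundedMoments P ε G q CG) {k n t : ℕ} (hn : 1 ≤ n) (htn : t ≤ n) :
    MemLp (localAverage ε G k n t) (ENNReal.ofReal q) P := by
  have h : MemLp (fun ω => ∑ i ∈ Finset.Icc (max (t - k) 1) t, obs ε G n i ω)
      (ENNReal.ofReal q) P := memLp_finsetSum _ fun i hi =>
    hε.memLp_past hG hmom hn (natCast_div_mem_Icc ((Finset.mem_Icc.mp hi).2.trans htn)) i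
  exact h.const_smul (((min k t : ℕ) : ℝ)⁻¹)

variable [IsProbabilityMeasure P]

theorem IIDWithCopy.exists_obs_sum_bound (hε : IIDWithCopy P ε ε') (hG : ∀ n u, Measurable (G n u))
    (hq : 2 < q) (hρ : 0 < ρ) (hρ1 : ρ < 1) (herg : UniformlyErgodic P ε ε' G q CG ρ)
    (hmom : UniformlyBoundedMoments P ε G q CG) :
    ∃ K : ℝ, 0 ≤ K ∧ ∀ n t N : ℕ, 1 ≤ n → t ≤ n → N ≤ t + 1 →
      eLpNorm (fun ω => ∑ r ∈ Finset.range N,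
        (obs ε G n (t - r) ω - localMean P ε (G n) (((t - r : ℕ) : ℝ) / n))) (ENNReal.ofReal q) P ≤
      ENNReal.ofReal (K * √N) := by
  obtain ⟨K, hK, hKb⟩ := hε.exists_sum_moment_bound hq hρ.le hρ1
  -- One scalar bound per coordinate gives the factor d; `max CG 0` is used because `CG` carries no
  -- sign assumption.
  refine ⟨d * (K * max CG 0), by positivity, fun n t N hn ht hN => ?_⟩
  have h1q : (1 : ℝ≥0∞) ≤ ENNReal.ofReal q := one_le_ofReal (by linarith)
  have hu : ∀ r : ℕ, ((t - r : ℕ) : ℝ) / n ∈ Set.Icc (0 : ℝ) 1 := fun r =>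
    natCast_div_mem_Icc ((Nat.sub_le _ _).trans ht)
  have hmem : ∀ (r : ℕ) (s : ℤ),
      MemLp (fun ω => G n (((t - r : ℕ) : ℝ) / n) (past ε s ω)) (ENNReal.ofReal q) P :=
    fun r s => hε.memLp_past hG hmom hn (hu r) s
  have hproj : ∀ c : Fin d, Measurable fun v : EuclideanSpace ℝ (Fin d) => v c := fun c =>
    (EuclideanSpace.proj c : EuclideanSpace ℝ (Fin d) →L[ℝ] ℝ).continuous.measurable
  have hcoord : ∀ (c : Fin d) (f : Ω → EuclideanSpace ℝ (Fin d)),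
      eLpNorm (fun ω => f ω c) (ENNReal.ofReal q) P ≤ eLpNorm f (ENNReal.ofReal q) P := fun c f =>
    eLpNorm_mono fun ω => PiLp.norm_apply_le (f ω) c
  have hsum : MemLp (fun ω => ∑ r ∈ Finset.range N, (obs ε G n (t - r) ω -
      localMean P ε (G n) (((t - r : ℕ) : ℝ) / n))) (ENNReal.ofReal q) P :=
    memLp_finsetSum _ fun r _ => (hmem r _).sub (memLp_const _)
  refine (eLpNorm_le_sum_coord hsum.1 h1q).trans ?_
  have hbound : ∀ c : Fin d, eLpNorm (fun ω => (∑ r ∈ Finset.range N, (obs ε G n (t - r) ω -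
      localMean P ε (G n) (((t - r : ℕ) : ℝ) / n))) c) (ENNReal.ofReal q) P ≤
      ENNReal.ofReal (K * max CG 0 * √N) := by
    intro c
    refine le_trans (le_of_eq (congrArg (fun f => eLpNorm f (ENNReal.ofReal q) P) ?_))
      (hKb (fun r x => G n (((t - r : ℕ) : ℝ) / n) x c) (max CG 0) t
      (fun r => (hproj c).comp (hG n _)) (le_max_right _ _) (fun r => ?_) (fun r j => ?_) N)
    · funext ω
      simp only [WithLp.ofLp_sum, Finset.sum_apply]
      refine Finset.sum_congr rfl fun r hr => ?_
      have hr' : r ≤ t := by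
        have := Finset.mem_range.mp hr
        omega
      rw [PiLp.sub_apply, obs, localMean, hε.integral_past (hG n _) 0 (t - r)]
      have h : ∫ ω, G n (((t - r : ℕ) : ℝ) / n) (past ε (t - r) ω) c ∂P =
          (∫ ω, G n (((t - r : ℕ) : ℝ) / n) (past ε (t - r) ω) ∂P) c :=
        (EuclideanSpace.proj c : EuclideanSpace ℝ (Fin d) →L[ℝ] ℝ).integral_comp_comm
          ((hmem r (t - r)).integrable h1q)
      have e : ((t - r : ℕ) : ℤ) = t - r := Nat.cast_sub hr'
      rw [h, e]
    · exact ⟨((hproj c).comp ((hG n _).comp (hε.measurable_past _))).aestronglyMeasurable,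
        (hcoord c _).trans_lt (hmem r _).2⟩
    · refine le_trans (hcoord c fun ω => G n (((t - r : ℕ) : ℝ) / n) (past ε (t - r) ω) -
        G n (((t - r : ℕ) : ℝ) / n) (pastReplace ε ε' (t - r) j ω))
        ((herg n hn _ (hu r) _ j).trans (ENNReal.ofReal_le_ofReal ?_))
      have : 0 ≤ ρ ^ j := by positivity
      exact mul_le_mul_of_nonneg_right (le_max_left _ _) this
  refine (Finset.sum_le_sum fun c _ => hbound c).trans (le_of_eq ?_)
  rw [Finset.sum_const, Finset.card_univ, Fintype.card_fin, nsmul_eq_mul, mul_assoc (d : ℝ),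
    ENNReal.ofReal_mul (Nat.cast_nonneg d), ENNReal.ofReal_natCast]

theorem IIDWithCopy.exists_localAverage_bound (hε : IIDWithCopy P ε ε')
    (hG : ∀ n u, Measurable (G n u))
    (hq : 2 < q) (hρ : 0 < ρ) (hρ1 : ρ < 1) (herg : UniformlyErgodic P ε ε' G q CG ρ)
    (hmom : UniformlyBoundedMoments P ε G q CG) :
    ∃ K : ℝ, 0 ≤ K ∧ ∀ k n t : ℕ, 1 ≤ k → 1 ≤ t → t ≤ n →
      eLpNorm (fun ω => localAverage ε G k n t ω - meanAverage (localMean P ε (G n)) k n t)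
        (ENNReal.ofReal q) P ≤ ENNReal.ofReal (K / √(min k t : ℕ)) := by
  obtain ⟨K, hK, hKb⟩ := hε.exists_obs_sum_bound hG hq hρ hρ1 herg hmom
  refine ⟨K * √2, by positivity, fun k n t hk ht htn => ?_⟩
  set N := t + 1 - max (t - k) 1 with hN
  have hmin : 1 ≤ min k t := le_min hk ht
  -- The window has k + 1 points if t > k and t points otherwise, while the divisor is k ∧ t; hence
  -- the factor √2.
  have hN2 : N ≤ 2 * min k t := by omega
  have e : (fun ω => localAverage ε G k n t ω - meanAverage (localMean P ε (G n)) k n t) =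
      ((min k t : ℕ) : ℝ)⁻¹ • fun ω => ∑ r ∈ Finset.range N, (obs ε G n (t - r) ω -
        localMean P ε (G n) (((t - r : ℕ) : ℝ) / n)) := by
    funext ω
    rw [localAverage, meanAverage, ← smul_sub, Pi.smul_apply, ← Finset.sum_sub_distrib,
      sum_Icc_eq_sum_range_sub fun i => obs ε G n i ω - localMean P ε (G n) ((i : ℝ) / n)]
  rw [e, eLpNorm_const_smul, Real.enorm_of_nonneg (by positivity)]
  refine (mul_le_mul_right (hKb n t N (ht.trans htn) htn (by omega)) _).trans ?_
  rw [← ENNReal.ofReal_mul (by positivity)]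
  refine ENNReal.ofReal_le_ofReal ?_
  have hm : (0 : ℝ) < (min k t : ℕ) := by exact_mod_cast hmin
  have h1 : √(N : ℝ) ≤ √2 * √(min k t : ℕ) := by
    rw [← Real.sqrt_mul (by norm_num)]
    exact Real.sqrt_le_sqrt (by exact_mod_cast hN2)
  calc ((min k t : ℕ) : ℝ)⁻¹ * (K * √N)
      ≤ ((min k t : ℕ) : ℝ)⁻¹ * (K * (√2 * √(min k t : ℕ))) := by gcongr
    _ = K * √2 / √(min k t : ℕ) := by
      have h2 := Real.mul_self_sqrt hm.le
      have h3 : √((min k t : ℕ) : ℝ) ≠ 0 := (Real.sqrt_pos.mpr hm).ne'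
      field_simp
      rw [sq, h2]
      ring

end LocStat

/-! ### Bias of the local average: p-variation and Hölder parts. -/

namespace LocStat

variable {d : ℕ}

/-- The p-variation only sees strict partitions that start at 0 and end at 1. This step turns a
monotone sequence, possibly with repetitions, into such a partition, one point at a time. -/
theorem exists_partition_snoc {p : ℝ} (hp : 1 ≤ p) {f : ℝ → EuclideanSpace ℝ (Fin d)} {S x y : ℝ}
    (hxy : x ≤ y)
    (h : ∃ (m : ℕ) (u : ℕ → ℝ), u 0 = 0 ∧ u m = x ∧ StrictMonoOn u (Set.Iic m) ∧
      S ≤ ∑ i ∈ Finset.range m, ‖f (u (i + 1)) - f (u i)‖ ^ p) :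
    ∃ (m : ℕ) (u : ℕ → ℝ), u 0 = 0 ∧ u m = y ∧ StrictMonoOn u (Set.Iic m) ∧
      S + ‖f y - f x‖ ^ p ≤ ∑ i ∈ Finset.range m, ‖f (u (i + 1)) - f (u i)‖ ^ p := by
  obtain ⟨m, u, h0, hm, hu, hS⟩ := h
  rcases hxy.eq_or_lt with rfl | hxy
  · refine ⟨m, u, h0, hm, hu, ?_⟩
    rw [sub_self, norm_zero, Real.zero_rpow (by linarith), add_zero]
    exact hS
  · refine ⟨m + 1, fun i => if i ≤ m then u i else y, by simp [h0], by simp, ?_, ?_⟩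
    · intro i _ j hj hij
      have hj : j ≤ m + 1 := hj
      have hi : i ≤ m := by omega
      simp only [if_pos hi]
      split_ifs with hjm
      · exact hu hi hjm hij
      · refine lt_of_le_of_lt ?_ hxy
        rw [← hm]
        exact hu.monotoneOn hi (Set.mem_Iic.mpr le_rfl) hi
    · rw [Finset.sum_range_succ]
      refine add_le_add (hS.trans (le_of_eq (Finset.sum_congr rfl fun i hi => ?_))) ?_
      · have := Finset.mem_range.mp hi
        simp only
        rw [if_pos (by omega), if_pos (by omega)]
      · simp [hm]

theorem sum_rpow_le_of_pVariation_le {p : ℝ} (hp : 1 ≤ p) {f : ℝ → EuclideanSpace ℝ (Fin d)}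
    {a : ℝ≥0} (hf : pVariation p f ≤ a) {v : ℕ → ℝ} (hv : Monotone v)
    (hv01 : ∀ i, v i ∈ Set.Icc (0 : ℝ) 1) (m : ℕ) :
    ∑ i ∈ Finset.range m, ‖f (v (i + 1)) - f (v i)‖ ^ p ≤ (a : ℝ) ^ p := by
  have hrefine : ∀ m : ℕ, ∃ (m' : ℕ) (u : ℕ → ℝ), u 0 = 0 ∧ u m' = v m ∧
      StrictMonoOn u (Set.Iic m') ∧ ∑ i ∈ Finset.range m, ‖f (v (i + 1)) - f (v i)‖ ^ p ≤
        ∑ i ∈ Finset.range m', ‖f (u (i + 1)) - f (u i)‖ ^ p := by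
    intro m
    induction m with
    | zero =>
      obtain ⟨m', u, h0, hm, hu, hS⟩ := exists_partition_snoc (f := f) (S := 0) hp (hv01 0).1
        ⟨0, fun _ => 0, rfl, rfl, fun i hi j hj hij => by
          have h1 : i ≤ 0 := hi
          have h2 : j ≤ 0 := hj
          omega, by simp⟩
      exact ⟨m', u, h0, hm, hu, by
        simp only [Finset.range_zero, Finset.sum_empty]
        exact Finset.sum_nonneg fun i _ => by positivity⟩
    | succ m ih =>
      obtain ⟨m', u, h0, hm, hu, hS⟩ := exists_partition_snoc hp (hv (Nat.le_succ m)) ih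
      exact ⟨m', u, h0, hm, hu, by rw [Finset.sum_range_succ]; exact hS⟩
  obtain ⟨m', u, h0, hm, hu, hS⟩ := exists_partition_snoc hp (hv01 m).2 (hrefine m)
  have hsum : 0 ≤ ∑ i ∈ Finset.range m', ‖f (u (i + 1)) - f (u i)‖ ^ p :=
    Finset.sum_nonneg fun i _ => by positivity
  have h1 : ENNReal.ofReal ((∑ i ∈ Finset.range m', ‖f (u (i + 1)) - f (u i)‖ ^ p) ^ (1 / p)) ≤
      (a : ℝ≥0∞) := by
    refine le_trans ?_ hf
    rw [pVariation]
    exact le_iSup_of_le m' (le_iSup_of_le u (le_iSup_of_le ⟨h0, hm, hu⟩ le_rfl))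
  rw [← ENNReal.ofReal_coe_nnreal, ENNReal.ofReal_le_ofReal_iff a.coe_nonneg, one_div,
    Real.rpow_inv_le_iff_of_pos hsum a.coe_nonneg (by linarith)] at h1
  have : 0 ≤ ‖f 1 - f (v m)‖ ^ p := by positivity
  linarith

theorem norm_sub_le_of_pVariation_le {p : ℝ} (hp : 1 ≤ p) {f : ℝ → EuclideanSpace ℝ (Fin d)}
    {a : ℝ≥0} (hf : pVariation p f ≤ a) {x y : ℝ} (hx : x ∈ Set.Icc (0 : ℝ) 1)
    (hy : y ∈ Set.Icc (0 : ℝ) 1) : ‖f x - f y‖ ≤ a := by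
  wlog h : y ≤ x generalizing x y
  · rw [norm_sub_rev]
    exact this hy hx (le_of_not_ge h)
  have h1 := sum_rpow_le_of_pVariation_le hp hf (v := fun i => if i = 0 then y else x)
    (fun i j hij => by
      simp only
      split_ifs <;> first | omega | simp) (fun i => by
      split_ifs
      · exact hy
      · exact hx) 1
  simp only [Finset.range_one, Finset.sum_singleton] at h1
  exact (Real.rpow_le_rpow_iff (norm_nonneg _) a.coe_nonneg (by linarith)).mp h1

theorem sum_range_mul_eq_sum_residues (F : ℕ → ℝ) (h M : ℕ) :
    ∑ s ∈ Finset.range (h * M), F s =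
      ∑ r ∈ Finset.range h, ∑ m ∈ Finset.range M, F (h * m + r) := by
  induction M with
  | zero => simp
  | succ M ih =>
    simp only [Finset.sum_range_succ, Finset.sum_add_distrib]
    rw [Nat.mul_succ, Finset.sum_range_add, ih]

/-- Along each residue class modulo h, lag-h increments are consecutive increments of a monotone
sequence, so each of the h classes contributes at most a^p. -/
theorem sum_lag_rpow_le_of_pVariation_le {p : ℝ} (hp : 1 ≤ p) {f : ℝ → EuclideanSpace ℝ (Fin d)}
    {a : ℝ≥0} (hf : pVariation p f ≤ a) {v : ℕ → ℝ} (hv : Monotone v)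
    (hv01 : ∀ i, v i ∈ Set.Icc (0 : ℝ) 1) (h M : ℕ) :
    ∑ s ∈ Finset.range (h * M), ‖f (v (s + h)) - f (v s)‖ ^ p ≤ h * (a : ℝ) ^ p := by
  rw [sum_range_mul_eq_sum_residues (fun s => ‖f (v (s + h)) - f (v s)‖ ^ p)]
  refine (Finset.sum_le_card_nsmul _ _ ((a : ℝ) ^ p) fun r _ => ?_).trans (by simp)
  have h1 := sum_rpow_le_of_pVariation_le hp hf (v := fun m => v (h * m + r))
    (fun i j hij => hv (by gcongr)) (fun i => hv01 _) M
  refine le_trans (le_of_eq (Finset.sum_congr rfl fun m _ => ?_)) h1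
  rw [show h * m + r + h = h * (m + 1) + r by ring]

theorem sum_lag_sq_le_of_pVariation_le {p : ℝ} (hp : 1 ≤ p) (hp2 : p ≤ 2)
    {f : ℝ → EuclideanSpace ℝ (Fin d)} {a : ℝ≥0} (hf : pVariation p f ≤ a) {n k h : ℕ}
    (hhk : h ≤ k) :
    ∑ t ∈ Finset.Icc (k + 1) n, ‖f (((t - h : ℕ) : ℝ) / n) - f ((t : ℝ) / n)‖ ^ 2 ≤
      h * (a : ℝ) ^ 2 := by
  rcases Nat.eq_zero_or_pos h with rfl | hh
  · simp
  -- Every increment is at most a, which trades the exponent p ≤ 2 for 2.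
  have hsq : ∀ x : ℝ, 0 ≤ x → x ≤ a → x ^ 2 ≤ (a : ℝ) ^ (2 - p) * x ^ p := fun x hx hxa => by
    calc x ^ 2 = x ^ (2 - p) * x ^ p := by
          rw [← Real.rpow_add_of_nonneg hx (by linarith) (by linarith), sub_add_cancel]
          norm_num
      _ ≤ _ := mul_le_mul_of_nonneg_right (Real.rpow_le_rpow hx hxa (by linarith)) (by positivity)
  -- Truncation at n keeps all points in [0, 1], so that the index range may be enlarged to a
  -- multiple of h.
  set v : ℕ → ℝ := fun s => ((min s n : ℕ) : ℝ) / n with hv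
  have hvm : Monotone v := fun i j hij => by
    simp only [hv]
    gcongr
  have hv01 : ∀ i, v i ∈ Set.Icc (0 : ℝ) 1 := fun i => natCast_div_mem_Icc (min_le_right i n)
  have hlag := sum_lag_rpow_le_of_pVariation_le hp hf hvm hv01 h n
  calc ∑ t ∈ Finset.Icc (k + 1) n, ‖f (((t - h : ℕ) : ℝ) / n) - f ((t : ℝ) / n)‖ ^ 2
      ≤ ∑ t ∈ Finset.Icc (k + 1) n, (a : ℝ) ^ (2 - p) * ‖f (v (t - h + h)) - f (v (t - h))‖ ^ p := by
        refine Finset.sum_le_sum fun t ht => ?_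
        have ht := Finset.mem_Icc.mp ht
        have e1 : v (t - h + h) = (t : ℝ) / n := by
          simp only [hv]
          congr 2
          omega
        have e2 : v (t - h) = ((t - h : ℕ) : ℝ) / n := by
          simp only [hv]
          congr 2
          omega
        rw [e1, e2, norm_sub_rev]
        exact hsq _ (norm_nonneg _) (norm_sub_le_of_pVariation_le hp hf
          (natCast_div_mem_Icc ht.2) (natCast_div_mem_Icc (by omega)))
    _ = (a : ℝ) ^ (2 - p) * ∑ s ∈ (Finset.Icc (k + 1) n).image fun t => t - h,
          ‖f (v (s + h)) - f (v s)‖ ^ p := by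
        rw [← Finset.mul_sum, Finset.sum_image]
        intro i hi j hj hij
        have hi := Finset.mem_Icc.mp hi
        have hj := Finset.mem_Icc.mp hj
        simp only at hij
        omega
    _ ≤ (a : ℝ) ^ (2 - p) * ∑ s ∈ Finset.range (h * n), ‖f (v (s + h)) - f (v s)‖ ^ p := by
        refine mul_le_mul_of_nonneg_left ?_ (by positivity)
        refine Finset.sum_le_sum_of_subset_of_nonneg ?_ fun _ _ _ => by positivity
        intro s hs
        obtain ⟨t, ht, rfl⟩ := Finset.mem_image.mp hs
        have ht := Finset.mem_Icc.mp ht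
        rw [Finset.mem_range]
        have : n ≤ h * n := Nat.le_mul_of_pos_left n hh
        omega
    _ ≤ (a : ℝ) ^ (2 - p) * (h * (a : ℝ) ^ p) := by gcongr
    _ = h * (a : ℝ) ^ 2 := by
        rw [mul_left_comm, ← Real.rpow_add_of_nonneg a.coe_nonneg (by linarith) (by linarith),
          sub_add_cancel]
        norm_num

/-- The average of `f (i / n)` over the window `max (t - k) 1 ≤ i ≤ t`. -/
noncomputable def windowAverage (f : ℝ → EuclideanSpace ℝ (Fin d)) (k n t : ℕ) :
    EuclideanSpace ℝ (Fin d) :=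
  ((Finset.Icc (max (t - k) 1) t).card : ℝ)⁻¹ •
    ∑ i ∈ Finset.Icc (max (t - k) 1) t, f ((i : ℝ) / n)

theorem card_window_pos {k t : ℕ} (ht : 1 ≤ t) :
    (0 : ℝ) < (Finset.Icc (max (t - k) 1) t).card := by
  rw [Nat.card_Icc]
  have : 0 < t + 1 - max (t - k) 1 := by omega
  exact_mod_cast this

theorem windowAverage_sub_const (f : ℝ → EuclideanSpace ℝ (Fin d)) {k n t : ℕ} (ht : 1 ≤ t)
    (c : EuclideanSpace ℝ (Fin d)) :
    windowAverage f k n t - c = ((Finset.Icc (max (t - k) 1) t).card : ℝ)⁻¹ •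
      ∑ i ∈ Finset.Icc (max (t - k) 1) t, (f ((i : ℝ) / n) - c) := by
  have h := (card_window_pos (k := k) ht).ne'
  rw [windowAverage, Finset.sum_sub_distrib, Finset.sum_const, smul_sub,
    ← Nat.cast_smul_eq_nsmul ℝ, inv_smul_smul₀ h]

theorem norm_windowAverage_sub_const_le (f : ℝ → EuclideanSpace ℝ (Fin d)) {k n t : ℕ} (ht : 1 ≤ t)
    {c : EuclideanSpace ℝ (Fin d)} {b : ℝ}
    (hb : ∀ i ∈ Finset.Icc (max (t - k) 1) t, ‖f ((i : ℝ) / n) - c‖ ≤ b) :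
    ‖windowAverage f k n t - c‖ ≤ b := by
  have h := card_window_pos (k := k) ht
  rw [windowAverage_sub_const f ht, norm_smul, Real.norm_of_nonneg (by positivity),
    inv_mul_le_iff₀ h]
  exact (norm_sum_le_of_le _ hb).trans (by simp)

theorem norm_windowAverage_sub_const_sq_le (f : ℝ → EuclideanSpace ℝ (Fin d)) {k n t : ℕ}
    (ht : 1 ≤ t) (c : EuclideanSpace ℝ (Fin d)) :
    ‖windowAverage f k n t - c‖ ^ 2 ≤ ((Finset.Icc (max (t - k) 1) t).card : ℝ)⁻¹ *
      ∑ i ∈ Finset.Icc (max (t - k) 1) t, ‖f ((i : ℝ) / n) - c‖ ^ 2 := by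
  have h := card_window_pos (k := k) ht
  rw [windowAverage_sub_const f ht, norm_smul, Real.norm_of_nonneg (by positivity), mul_pow, sq,
    mul_assoc]
  refine mul_le_mul_of_nonneg_left ?_ (by positivity)
  rw [inv_mul_le_iff₀ h]
  refine le_trans ?_ sq_sum_le_card_mul_sum_sq
  gcongr
  exact norm_sum_le _ _

/-- The first k times contribute at most a² each. Later windows have exactly k + 1 points, so Jensen
reduces their sum to an average over lags h ≤ k of lag sums, each at most k a². -/
theorem sum_windowAverage_sub_sq_le_of_pVariation_le {p : ℝ} (hp : 1 ≤ p) (hp2 : p ≤ 2)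
    {f : ℝ → EuclideanSpace ℝ (Fin d)} {a : ℝ≥0} (hf : pVariation p f ≤ a) (k n : ℕ) :
    ∑ t ∈ Finset.Icc 1 n, ‖windowAverage f k n t - f ((t : ℝ) / n)‖ ^ 2 ≤
      2 * k * (a : ℝ) ^ 2 := by
  have hsplit : Finset.Icc 1 n ⊆ Finset.Icc 1 (min k n) ∪ Finset.Icc (k + 1) n := by
    intro t ht
    simp only [Finset.mem_union, Finset.mem_Icc] at *
    omega
  have hsmall : ∑ t ∈ Finset.Icc 1 (min k n), ‖windowAverage f k n t - f ((t : ℝ) / n)‖ ^ 2 ≤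
      k * (a : ℝ) ^ 2 := by
    refine (Finset.sum_le_card_nsmul _ _ ((a : ℝ) ^ 2) fun t ht => ?_).trans ?_
    · have ht := Finset.mem_Icc.mp ht
      have htn : t ≤ n := ht.2.trans (min_le_right _ _)
      refine pow_le_pow_left₀ (norm_nonneg _) (norm_windowAverage_sub_const_le f ht.1
        fun i hi => norm_sub_le_of_pVariation_le hp hf
          (natCast_div_mem_Icc ((Finset.mem_Icc.mp hi).2.trans htn)) (natCast_div_mem_Icc htn)) 2
    · rw [nsmul_eq_mul, Nat.card_Icc]
      have : ((min k n + 1 - 1 : ℕ) : ℝ) ≤ k := by exact_mod_cast (by omega)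
      gcongr
  have hlarge : ∑ t ∈ Finset.Icc (k + 1) n, ‖windowAverage f k n t - f ((t : ℝ) / n)‖ ^ 2 ≤
      k * (a : ℝ) ^ 2 := by
    calc ∑ t ∈ Finset.Icc (k + 1) n, ‖windowAverage f k n t - f ((t : ℝ) / n)‖ ^ 2
        ≤ ∑ t ∈ Finset.Icc (k + 1) n, ((k + 1 : ℕ) : ℝ)⁻¹ * ∑ h ∈ Finset.range (k + 1),
            ‖f (((t - h : ℕ) : ℝ) / n) - f ((t : ℝ) / n)‖ ^ 2 := by
          refine Finset.sum_le_sum fun t ht => ?_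
          have ht := Finset.mem_Icc.mp ht
          have hcard : t + 1 - max (t - k) 1 = k + 1 := by omega
          refine (norm_windowAverage_sub_const_sq_le f (by omega) _).trans (le_of_eq ?_)
          rw [sum_Icc_eq_sum_range_sub fun i : ℕ => ‖f ((i : ℝ) / n) - f ((t : ℝ) / n)‖ ^ 2,
            Nat.card_Icc, hcard]
      _ = ((k + 1 : ℕ) : ℝ)⁻¹ * ∑ h ∈ Finset.range (k + 1), ∑ t ∈ Finset.Icc (k + 1) n,
            ‖f (((t - h : ℕ) : ℝ) / n) - f ((t : ℝ) / n)‖ ^ 2 := by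
          rw [← Finset.mul_sum, Finset.sum_comm]
      _ ≤ ((k + 1 : ℕ) : ℝ)⁻¹ * ∑ h ∈ Finset.range (k + 1), (k * (a : ℝ) ^ 2) := by
          refine mul_le_mul_of_nonneg_left (Finset.sum_le_sum fun h hh => ?_) (by positivity)
          have hh : h ≤ k := Nat.lt_succ_iff.mp (Finset.mem_range.mp hh)
          refine (sum_lag_sq_le_of_pVariation_le hp hp2 hf hh).trans ?_
          gcongr
      _ = k * (a : ℝ) ^ 2 := by
          rw [Finset.sum_const, Finset.card_range, nsmul_eq_mul,
            inv_mul_cancel_left₀ (by positivity)]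
  calc ∑ t ∈ Finset.Icc 1 n, ‖windowAverage f k n t - f ((t : ℝ) / n)‖ ^ 2
      ≤ ∑ t ∈ Finset.Icc 1 (min k n) ∪ Finset.Icc (k + 1) n,
          ‖windowAverage f k n t - f ((t : ℝ) / n)‖ ^ 2 :=
        Finset.sum_le_sum_of_subset_of_nonneg hsplit fun _ _ _ => by positivity
    _ ≤ _ := by
        rw [Finset.sum_union]
        · linarith
        · rw [Finset.disjoint_left]
          intro t h1 h2
          simp only [Finset.mem_Icc] at h1 h2
          omega

theorem norm_windowAverage_sub_le_of_holderOnWith {C β : ℝ≥0} {f : ℝ → EuclideanSpace ℝ (Fin d)}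
    (hf : HolderOnWith C β f (Set.Icc 0 1)) {k n t : ℕ} (ht : 1 ≤ t) (htn : t ≤ n) :
    ‖windowAverage f k n t - f ((t : ℝ) / n)‖ ≤ C * ((k : ℝ) / n) ^ (β : ℝ) := by
  refine norm_windowAverage_sub_const_le f ht fun i hi => ?_
  have hi := Finset.mem_Icc.mp hi
  have h := hf.dist_le (natCast_div_mem_Icc (hi.2.trans htn)) (natCast_div_mem_Icc htn)
  rw [dist_eq_norm] at h
  refine h.trans ?_
  have hd : dist ((i : ℝ) / n) ((t : ℝ) / n) ≤ (k : ℝ) / n := by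
    rw [dist_comm, Real.dist_eq, ← sub_div, abs_div, abs_of_nonneg (show (0 : ℝ) ≤ n by positivity)]
    refine div_le_div_of_nonneg_right ?_ (by positivity)
    have h1 : (i : ℝ) ≤ t := by exact_mod_cast hi.2
    rw [abs_of_nonneg (by linarith)]
    have h2 : t ≤ k + i := by omega
    have h3 : (t : ℝ) ≤ k + i := by exact_mod_cast h2
    linarith
  gcongr

/-- For t > k the estimator divides k + 1 terms by k; the excess is 1/k times a genuine average. -/
theorem norm_meanAverage_sub_windowAverage_le {f : ℝ → EuclideanSpace ℝ (Fin d)} {b : ℝ}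
    {k n t : ℕ} (hk : 1 ≤ k) (ht : 1 ≤ t) (htn : t ≤ n)
    (hb : ∀ u ∈ Set.Icc (0 : ℝ) 1, ‖f u‖ ≤ b) :
    ‖meanAverage f k n t - windowAverage f k n t‖ ≤ b / k := by
  have hb0 : 0 ≤ b := (norm_nonneg _).trans (hb 0 (by simp))
  rcases le_or_gt t k with h | h
  · have : meanAverage f k n t = windowAverage f k n t := by
      have e : t + 1 - max (t - k) 1 = min k t := by omega
      rw [meanAverage, windowAverage, Nat.card_Icc, e]
    rw [this, sub_self, norm_zero]
    positivity
  · have e : t + 1 - max (t - k) 1 = k + 1 := by omega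
    have e' : min k t = k := by omega
    have hk0 : (0 : ℝ) < k := by exact_mod_cast hk
    have h1 : ‖windowAverage f k n t‖ ≤ b := by
      have := norm_windowAverage_sub_const_le f (k := k) (n := n) (c := 0) (b := b) ht fun i hi => by
        rw [sub_zero]
        exact hb _ (natCast_div_mem_Icc ((Finset.mem_Icc.mp hi).2.trans htn))
      simpa using this
    have h2 : meanAverage f k n t - windowAverage f k n t =
        (k : ℝ)⁻¹ • windowAverage f k n t := by
      rw [meanAverage, windowAverage, Nat.card_Icc, e, e', ← sub_smul, smul_smul]
      congr 1
      push_cast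
      field_simp
      ring
    rw [h2, norm_smul, Real.norm_of_nonneg (by positivity), inv_mul_eq_div]
    gcongr

theorem norm_add_three_sq_le {E : Type*} [SeminormedAddCommGroup E] (x y z : E) :
    ‖x + y + z‖ ^ 2 ≤ 3 * (‖x‖ ^ 2 + ‖y‖ ^ 2 + ‖z‖ ^ 2) := by
  have h : ‖x + y + z‖ ≤ ‖x‖ + ‖y‖ + ‖z‖ := norm_add₃_le
  have h1 := pow_le_pow_left₀ (norm_nonneg _) h 2
  nlinarith [sq_nonneg (‖x‖ - ‖y‖), sq_nonneg (‖y‖ - ‖z‖), sq_nonneg (‖x‖ - ‖z‖)]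

theorem sum_meanAverage_sub_sq_le {p : ℝ} (hp : 1 ≤ p) (hp2 : p ≤ 2) {C β a : ℝ≥0}
    {μ μ₁ μ₂ : ℝ → EuclideanSpace ℝ (Fin d)} {b : ℝ}
    (hμ : ∀ u ∈ Set.Icc (0 : ℝ) 1, μ u = μ₁ u + μ₂ u) (hb : ∀ u ∈ Set.Icc (0 : ℝ) 1, ‖μ u‖ ≤ b)
    (h₁ : HolderOnWith C β μ₁ (Set.Icc 0 1)) (h₂ : pVariation p μ₂ ≤ a) {k n : ℕ} (hk : 1 ≤ k) :
    ∑ t ∈ Finset.Icc 1 n, ‖meanAverage μ k n t - μ ((t : ℝ) / n)‖ ^ 2 ≤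
      3 * (n * (C * ((k : ℝ) / n) ^ (β : ℝ)) ^ 2 + 2 * k * (a : ℝ) ^ 2 + n * (b / k) ^ 2) := by
  have hb0 : 0 ≤ b := (norm_nonneg _).trans (hb 0 (by simp))
  have hw : ∀ t ∈ Finset.Icc 1 n, ‖meanAverage μ k n t - μ ((t : ℝ) / n)‖ ^ 2 ≤
      3 * ((C * ((k : ℝ) / n) ^ (β : ℝ)) ^ 2 + ‖windowAverage μ₂ k n t - μ₂ ((t : ℝ) / n)‖ ^ 2 +
        (b / k) ^ 2) := by
    intro t ht
    obtain ⟨ht, htn⟩ := Finset.mem_Icc.mp ht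
    have e : windowAverage μ k n t = windowAverage μ₁ k n t + windowAverage μ₂ k n t := by
      rw [windowAverage, windowAverage, windowAverage, ← smul_add, ← Finset.sum_add_distrib]
      congr 1
      refine Finset.sum_congr rfl fun i hi => hμ _ ?_
      exact natCast_div_mem_Icc ((Finset.mem_Icc.mp hi).2.trans htn)
    have e' : meanAverage μ k n t - μ ((t : ℝ) / n) =
        (windowAverage μ₁ k n t - μ₁ ((t : ℝ) / n)) + (windowAverage μ₂ k n t - μ₂ ((t : ℝ) / n)) +
        (meanAverage μ k n t - windowAverage μ k n t) := by
      rw [hμ _ (natCast_div_mem_Icc htn), e]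
      abel
    rw [e']
    refine (norm_add_three_sq_le _ _ _).trans ?_
    gcongr
    · exact norm_windowAverage_sub_le_of_holderOnWith h₁ ht htn
    · exact norm_meanAverage_sub_windowAverage_le hk ht htn hb
  refine (Finset.sum_le_sum hw).trans ?_
  rw [← Finset.mul_sum, Finset.sum_add_distrib, Finset.sum_add_distrib]
  simp only [Finset.sum_const, Nat.card_Icc, add_tsub_cancel_right, nsmul_eq_mul]
  have := sum_windowAverage_sub_sq_le_of_pVariation_le hp hp2 h₂ k n
  gcongr

end LocStat

/-! ### Expected sum of squared errors. -/

theorem norm_integral_le_of_eLpNorm_le {Ω E : Type*} [MeasurableSpace Ω] {P : Measure Ω}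
    [IsProbabilityMeasure P] [NormedAddCommGroup E] [NormedSpace ℝ E] {f : Ω → E}
    (hf : AEStronglyMeasurable f P) {p : ℝ≥0∞} (hp : 1 ≤ p) {c : ℝ} (hc : 0 ≤ c)
    (h : eLpNorm f p P ≤ ENNReal.ofReal c) : ‖∫ ω, f ω ∂P‖ ≤ c := by
  rw [← ENNReal.ofReal_le_ofReal_iff hc, ofReal_norm]
  refine (enorm_integral_le_lintegral_enorm f).trans ?_
  rw [← eLpNorm_one_eq_lintegral_enorm]
  exact (eLpNorm_le_eLpNorm_of_exponent_le hp hf).trans h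

theorem inv_min_le_add_inv (k t : ℕ) : (((min k t : ℕ) : ℝ))⁻¹ ≤ (k : ℝ)⁻¹ + (t : ℝ)⁻¹ := by
  have h1 : (0 : ℝ) ≤ (k : ℝ)⁻¹ := by positivity
  have h2 : (0 : ℝ) ≤ (t : ℝ)⁻¹ := by positivity
  rcases min_choice k t with h | h <;> rw [h] <;> linarith

theorem one_le_log_natCast {n : ℕ} (hn : 3 ≤ n) : 1 ≤ Real.log n := by
  have h3 : (3 : ℝ) ≤ n := by exact_mod_cast hn
  rw [Real.le_log_iff_exp_le (by linarith)]
  exact (Real.exp_one_lt_d9.le.trans (by norm_num)).trans h3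

/-- From 1/(k ∧ t) ≤ 1/k + 1/t the sum is at most n/k + 1 + log n; the conditions k ≤ n and n ≥ 3
make n/k and log n at least 1. -/
theorem sum_inv_min_le {k n : ℕ} (hk : 1 ≤ k) (hkn : k ≤ n) (hn : 3 ≤ n) :
    ∑ t ∈ Finset.Icc 1 n, (((min k t : ℕ) : ℝ))⁻¹ ≤ 3 * (n * Real.log n / k) := by
  have hk0 : (0 : ℝ) < k := by exact_mod_cast hk
  have hn0 : (0 : ℝ) < n := by exact_mod_cast (by omega : 0 < n)
  have hkn' : (k : ℝ) ≤ n := by exact_mod_cast hkn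
  have hlog : 1 ≤ Real.log n := one_le_log_natCast hn
  have hnk : 1 ≤ (n : ℝ) / k := by rwa [le_div_iff₀ hk0, one_mul]
  have hharm : ∑ t ∈ Finset.Icc 1 n, (t : ℝ)⁻¹ ≤ 1 + Real.log n := by
    have := harmonic_le_one_add_log n
    rw [harmonic_eq_sum_Icc] at this
    push_cast at this
    exact this
  calc ∑ t ∈ Finset.Icc 1 n, (((min k t : ℕ) : ℝ))⁻¹
      ≤ ∑ t ∈ Finset.Icc 1 n, ((k : ℝ)⁻¹ + (t : ℝ)⁻¹) :=
        Finset.sum_le_sum fun t _ => inv_min_le_add_inv k t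
    _ ≤ n / k + (1 + Real.log n) := by
        rw [Finset.sum_add_distrib]
        simp only [Finset.sum_const, Nat.card_Icc, add_tsub_cancel_right, nsmul_eq_mul]
        rw [← div_eq_mul_inv]
        linarith
    _ ≤ 3 * (n * Real.log n / k) := by
        rw [mul_div_right_comm]
        nlinarith

namespace LocStat

variable {Ω : Type*} [m0 : MeasurableSpace Ω] {P : Measure Ω} [IsProbabilityMeasure P]
  {ε ε' : ℤ → Ω → ℝ} {d : ℕ}
  {G : ℕ → ℝ → (ℕ → ℝ) → EuclideanSpace ℝ (Fin d)} {q CG ρ : ℝ}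

theorem IIDWithCopy.norm_localMean_le (hε : IIDWithCopy P ε ε') (hG : ∀ n u, Measurable (G n u))
    (hq : 2 < q) (hmom : UniformlyBoundedMoments P ε G q CG) {n : ℕ} (hn : 1 ≤ n) {u : ℝ}
    (hu : u ∈ Set.Icc (0 : ℝ) 1) : ‖localMean P ε (G n) u‖ ≤ max CG 0 :=
  norm_integral_le_of_eLpNorm_le (hε.memLp_past hG hmom hn hu 0).1 (one_le_ofReal (by linarith))
    (le_max_right _ _)
    ((hmom n hn u hu).trans (ENNReal.ofReal_le_ofReal (le_max_left _ _)))

theorem IIDWithCopy.integral_norm_localAverage_sub_sq_le (hε : IIDWithCopy P ε ε')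
    (hG : ∀ n u, Measurable (G n u)) (hq : 2 < q) (hmom : UniformlyBoundedMoments P ε G q CG)
    {K : ℝ} (hK : 0 ≤ K) {k n t : ℕ} (hn : 1 ≤ n) (htn : t ≤ n)
    (h : eLpNorm (fun ω => localAverage ε G k n t ω - meanAverage (localMean P ε (G n)) k n t)
        (ENNReal.ofReal q) P ≤ ENNReal.ofReal (K / √(min k t : ℕ))) :
    ∫ ω, ‖localAverage ε G k n t ω - meanAverage (localMean P ε (G n)) k n t‖ ^ 2 ∂P ≤
      K ^ 2 * (((min k t : ℕ) : ℝ))⁻¹ := by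
  have hm := (hε.memLp_localAverage (k := k) hG hmom hn htn).sub
    (memLp_const (μ := P) (meanAverage (localMean P ε (G n)) k n t))
  have hq2 : ENNReal.ofReal 2 ≤ ENNReal.ofReal q := ENNReal.ofReal_le_ofReal hq.le
  have h2 := (eLpNorm_le_ofReal_iff (by norm_num) (hm.mono_exponent hq2) (by positivity)).mp
    ((eLpNorm_le_eLpNorm_of_exponent_le hq2 hm.1).trans h)
  simp only [Real.rpow_two, Pi.sub_apply] at h2
  refine h2.trans (le_of_eq ?_)
  rw [div_pow, Real.sq_sqrt (by positivity), div_eq_mul_inv]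

theorem IIDWithCopy.memLp_two_localAverage (hε : IIDWithCopy P ε ε')
    (hG : ∀ n u, Measurable (G n u)) (hq : 2 < q) (hmom : UniformlyBoundedMoments P ε G q CG)
    {k n t : ℕ} (hn : 1 ≤ n) (htn : t ≤ n) : MemLp (localAverage ε G k n t) 2 P := by
  refine (hε.memLp_localAverage hG hmom hn htn).mono_exponent ?_
  have := ENNReal.ofReal_le_ofReal hq.le
  simpa using this

theorem IIDWithCopy.integrable_norm_localAverage_sub_sq (hε : IIDWithCopy P ε ε')
    (hG : ∀ n u, Measurable (G n u)) (hq : 2 < q) (hmom : UniformlyBoundedMoments P ε G q CG)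
    {k n t : ℕ} (hn : 1 ≤ n) (htn : t ≤ n) (c : EuclideanSpace ℝ (Fin d)) :
    Integrable (fun ω => ‖localAverage ε G k n t ω - c‖ ^ 2) P :=
  ((hε.memLp_two_localAverage hG hq hmom hn htn).sub (memLp_const c)).integrable_norm_pow (by simp)

/-- Variance plus squared bias, each with a factor 2. The bound keeps a², which the rate and the
consistency statement later reduce to a in different ways. -/
theorem IIDWithCopy.exists_sum_squared_error_bound (hε : IIDWithCopy P ε ε')
    (hG : ∀ n u, Measurable (G n u))
    (hq : 2 < q) (hρ : 0 < ρ) (hρ1 : ρ < 1) (herg : UniformlyErgodic P ε ε' G q CG ρ)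
    (hmom : UniformlyBoundedMoments P ε G q CG) {p : ℝ} (hp : 1 ≤ p) (hp2 : p ≤ 2) (C β : ℝ≥0) :
    ∃ K : ℝ, 0 < K ∧ ∀ (a : ℝ≥0) (μ₁ μ₂ : ℝ → EuclideanSpace ℝ (Fin d)) (k n : ℕ),
      3 ≤ n → 1 ≤ k → k ≤ n →
      (∀ u ∈ Set.Icc (0 : ℝ) 1, localMean P ε (G n) u = μ₁ u + μ₂ u) →
      HolderOnWith C β μ₁ (Set.Icc (0 : ℝ) 1) → pVariation p μ₂ ≤ a →
      ∫ ω, ∑ t ∈ Finset.Icc 1 n,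
        ‖localAverage ε G k n t ω - localMean P ε (G n) ((t : ℝ) / n)‖ ^ 2 ∂P ≤
      K * ((a : ℝ) ^ 2 * k + n * ((k : ℝ) / n) ^ (2 * (β : ℝ)) + n * Real.log n / k) := by
  obtain ⟨K, hK, hKb⟩ := hε.exists_localAverage_bound hG hq hρ hρ1 herg hmom
  set b := max CG 0 with hbdef
  refine ⟨6 * (C : ℝ) ^ 2 + 12 + 6 * b ^ 2 + 6 * K ^ 2, by positivity,
    fun a μ₁ μ₂ k n hn hk hkn hμ h₁ h₂ => ?_⟩
  have hn1 : 1 ≤ n := by omega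
  have hk0 : (0 : ℝ) < k := by exact_mod_cast hk
  have hn0 : (0 : ℝ) < n := by exact_mod_cast hn1
  have hbias := sum_meanAverage_sub_sq_le (n := n) hp hp2 hμ
    (fun u hu => hε.norm_localMean_le hG hq hmom hn1 hu) h₁ h₂ hk
  have hint : ∀ t ∈ Finset.Icc 1 n, ∀ c : EuclideanSpace ℝ (Fin d),
      Integrable (fun ω => ‖localAverage ε G k n t ω - c‖ ^ 2) P := fun t ht c =>
    hε.integrable_norm_localAverage_sub_sq hG hq hmom hn1 (Finset.mem_Icc.mp ht).2 c
  have hterm : ∀ t ∈ Finset.Icc 1 n,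
      ∫ ω, ‖localAverage ε G k n t ω - localMean P ε (G n) ((t : ℝ) / n)‖ ^ 2 ∂P ≤
      2 * (K ^ 2 * (((min k t : ℕ) : ℝ))⁻¹) + 2 * ‖meanAverage (localMean P ε (G n)) k n t -
        localMean P ε (G n) ((t : ℝ) / n)‖ ^ 2 := by
    intro t ht
    obtain ⟨ht1, htn⟩ := Finset.mem_Icc.mp ht
    set m := meanAverage (localMean P ε (G n)) k n t with hm
    set c := localMean P ε (G n) ((t : ℝ) / n)
    have hv := hε.integral_norm_localAverage_sub_sq_le hG hq hmom hK hn1 htn (hKb k n t hk ht1 htn)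
    calc ∫ ω, ‖localAverage ε G k n t ω - c‖ ^ 2 ∂P
        ≤ ∫ ω, (2 * ‖localAverage ε G k n t ω - m‖ ^ 2 + 2 * ‖m - c‖ ^ 2) ∂P := by
          refine integral_mono (hint t ht c) (((hint t ht m).const_mul 2).add (integrable_const _))
            fun ω => ?_
          have h := norm_add_le (localAverage ε G k n t ω - m) (m - c)
          rw [sub_add_sub_cancel] at h
          have h' := pow_le_pow_left₀ (norm_nonneg _) h 2
          simp only
          nlinarith [sq_nonneg (‖localAverage ε G k n t ω - m‖ - ‖m - c‖)]
      _ = 2 * ∫ ω, ‖localAverage ε G k n t ω - m‖ ^ 2 ∂P + 2 * ‖m - c‖ ^ 2 := by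
          rw [integral_add ((hint t ht m).const_mul 2) (integrable_const _), integral_const_mul]
          simp
      _ ≤ _ := by linarith
  rw [integral_finsetSum _ fun t ht => hint t ht _]
  refine (Finset.sum_le_sum hterm).trans ?_
  rw [Finset.sum_add_distrib, ← Finset.mul_sum, ← Finset.mul_sum, ← Finset.mul_sum]
  have hmin := sum_inv_min_le hk hkn hn
  have hpow : (C * ((k : ℝ) / n) ^ (β : ℝ)) ^ 2 = C ^ 2 * ((k : ℝ) / n) ^ (2 * (β : ℝ)) := by
    rw [mul_pow, ← Real.rpow_mul_natCast (by positivity)]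
    congr 2
    push_cast
    ring
  rw [hpow] at hbias
  have hlog : 1 ≤ Real.log n := one_le_log_natCast hn
  -- The normalisation error is absorbed into the variance term.
  have hb : n * (b / k) ^ 2 ≤ b ^ 2 * (n * Real.log n / k) := by
    have h1 : (1 : ℝ) ≤ k := by exact_mod_cast hk
    have h2 : n * (b / k) ^ 2 = b ^ 2 * (n / k) * (1 / k) := by field_simp
    have h3 : (n : ℝ) / k ≤ n * Real.log n / k := by
      gcongr
      nlinarith
    have h4 : 1 / (k : ℝ) ≤ 1 := by
      rw [div_le_one hk0]
      exact h1
    rw [h2]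
    calc b ^ 2 * (n / k) * (1 / k) ≤ b ^ 2 * (n / k) * 1 := by gcongr
      _ ≤ _ := by rw [mul_one]; gcongr
  set X := (a : ℝ) ^ 2 * k with hX
  set Y := n * ((k : ℝ) / n) ^ (2 * (β : ℝ)) with hY
  set Z := n * Real.log n / k with hZ
  have hX0 : 0 ≤ X := by positivity
  have hY0 : 0 ≤ Y := by positivity
  have hZ0 : 0 ≤ Z := by
    have : 0 ≤ Real.log n := by linarith
    positivity
  have hb2 : 0 ≤ b ^ 2 := sq_nonneg _
  have hC2 : 0 ≤ (C : ℝ) ^ 2 := sq_nonneg _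
  have hK2 : 0 ≤ K ^ 2 := sq_nonneg _
  have hv : K ^ 2 * ∑ t ∈ Finset.Icc 1 n, (((min k t : ℕ) : ℝ))⁻¹ ≤ 3 * (K ^ 2 * Z) :=
    (mul_le_mul_of_nonneg_left hmin hK2).trans (le_of_eq (by ring))
  have e1 : n * (C ^ 2 * ((k : ℝ) / n) ^ (2 * (β : ℝ))) = C ^ 2 * Y := by rw [hY]; ring
  have e2 : 2 * k * (a : ℝ) ^ 2 = 2 * X := by rw [hX]; ring
  rw [e1, e2] at hbias
  have hprod : 0 ≤ (C : ℝ) ^ 2 * X + C ^ 2 * Z + Y + Z + b ^ 2 * X + b ^ 2 * Y + K ^ 2 * X +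
    K ^ 2 * Y := by positivity
  nlinarith

end LocStat

/-! ### Rates in probability and feasible bandwidths. -/

theorem measure_abs_gt_le_of_integral_le {Ω : Type*} [MeasurableSpace Ω] {P : Measure Ω}
    [IsProbabilityMeasure P] {f : Ω → ℝ} (hf0 : ∀ ω, 0 ≤ f ω) (hf : Integrable f P) {c η : ℝ}
    (hc : 0 < c) (h : ∫ ω, f ω ∂P ≤ η * c) : P {ω | c < |f ω|} ≤ ENNReal.ofReal η := by
  have h1 := (mul_meas_ge_le_integral_of_nonneg (ae_of_all _ hf0) hf c).trans h
  rw [mul_comm] at h1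
  have h2 : P.real {ω | c ≤ f ω} ≤ η := le_of_mul_le_mul_right h1 hc
  have h3 : P {ω | c < |f ω|} ≤ P {ω | c ≤ f ω} := measure_mono fun ω hω => by
    have hω : c < |f ω| := hω
    rw [abs_of_nonneg (hf0 ω)] at hω
    exact hω.le
  refine h3.trans ?_
  rw [← ENNReal.ofReal_toReal (measure_ne_top P {ω | c ≤ f ω})]
  exact ENNReal.ofReal_le_ofReal h2

theorem exists_bandwidth {β : ℝ} (hβ : 1 / 2 < β) : ∃ κ : ℕ → ℕ,
    (fun n : ℕ => Real.sqrt n * Real.log n) =o[atTop] (fun n => (κ n : ℝ)) ∧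
    (fun n => (κ n : ℝ)) =o[atTop] (fun n : ℕ => (n : ℝ) ^ ((4 * β - 1) / (4 * β))) := by
  set e := (4 * β - 1) / (4 * β) with he
  have he2 : 1 / 2 < e := by
    rw [he, lt_div_iff₀ (by linarith)]
    linarith
  -- An exponent strictly between 1/2 and e; the gap exists exactly because β > 1/2, and n^(s-1/2)
  -- beats log n.
  set s := (1 / 2 + e) / 2 with hs
  have hcast : Tendsto (fun n : ℕ => (n : ℝ)) atTop atTop := tendsto_natCast_atTop_atTop
  refine ⟨fun n => ⌈(n : ℝ) ^ s⌉₊, ?_, ?_⟩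
  · have h1 : (fun n : ℕ => Real.sqrt n * Real.log n) =o[atTop]
        (fun n : ℕ => Real.sqrt n * (n : ℝ) ^ (s - 1 / 2)) :=
      (isBigO_refl _ _).mul_isLittleO
        ((isLittleO_log_rpow_atTop (by linarith)).comp_tendsto hcast)
    refine h1.trans_isBigO (IsBigO.of_bound 1 ?_)
    filter_upwards [eventually_gt_atTop 0] with n hn
    have hn0 : (0 : ℝ) < n := by exact_mod_cast hn
    rw [Real.sqrt_eq_rpow, ← Real.rpow_add hn0, add_sub_cancel, one_mul,
      Real.norm_of_nonneg (by positivity), Real.norm_of_nonneg (by positivity)]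
    exact Nat.le_ceil _
  · have h1 : (fun n : ℕ => (n : ℝ) ^ s) =o[atTop] (fun n : ℕ => (n : ℝ) ^ e) := by
      refine isLittleO_of_tendsto' ?_ ?_
      · filter_upwards [eventually_gt_atTop 0] with n hn h
        have hn0 : (0 : ℝ) < n := by exact_mod_cast hn
        exact absurd h (Real.rpow_pos_of_pos hn0 _).ne'
      · refine ((tendsto_rpow_neg_atTop (show 0 < e - s by linarith)).comp hcast).congr' ?_
        filter_upwards [eventually_gt_atTop 0] with n hn
        have hn0 : (0 : ℝ) < n := by exact_mod_cast hn
        rw [Function.comp_apply, neg_sub, Real.rpow_sub hn0]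
    refine IsBigO.trans_isLittleO (IsBigO.of_bound 2 ?_) h1
    filter_upwards [eventually_gt_atTop 0] with n hn
    have hn1 : (1 : ℝ) ≤ n := by exact_mod_cast hn
    have h2 : 1 ≤ (n : ℝ) ^ s := Real.one_le_rpow hn1 (by linarith)
    rw [Real.norm_of_nonneg (by positivity), Real.norm_of_nonneg (by positivity)]
    have := Nat.ceil_lt_add_one (show 0 ≤ (n : ℝ) ^ s by positivity)
    linarith

/-- With e = (4β - 1)/(4β) one has 2βe = 2β - 1/2, so the expression equals (k/n^e)^(2β). -/
theorem tendsto_rpow_mul_div_sqrt {k : ℕ → ℕ} {β : ℝ} (hβ : 0 < β)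
    (hk : (fun n => (k n : ℝ)) =o[atTop] (fun n : ℕ => (n : ℝ) ^ ((4 * β - 1) / (4 * β)))) :
    Tendsto (fun n : ℕ => n * ((k n : ℝ) / n) ^ (2 * β) / √n) atTop (𝓝 0) := by
  have h := hk.tendsto_div_nhds_zero.rpow_const (p := 2 * β) (Or.inr (by linarith))
  rw [Real.zero_rpow (by linarith)] at h
  refine h.congr' ?_
  filter_upwards [eventually_gt_atTop 0] with n hn
  have hn0 : (0 : ℝ) < n := by exact_mod_cast hn
  rw [Real.div_rpow (by positivity) (by positivity), Real.div_rpow (by positivity) (by positivity),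
    ← Real.rpow_mul hn0.le, Real.sqrt_eq_rpow]
  have e : (4 * β - 1) / (4 * β) * (2 * β) = 2 * β - 1 + 1 / 2 := by field_simp; ring
  rw [e, Real.rpow_add hn0, Real.rpow_sub_one hn0.ne']
  field_simp

namespace LocStat

variable {Ω : Type*} [m0 : MeasurableSpace Ω] {P : Measure Ω} [IsProbabilityMeasure P]
  {ε ε' : ℤ → Ω → ℝ} {d : ℕ}
  {G : ℕ → ℝ → (ℕ → ℝ) → EuclideanSpace ℝ (Fin d)} {q CG ρ : ℝ}

theorem IIDWithCopy.isBigOP_mean_squared_error (hε : IIDWithCopy P ε ε')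
    (hG : ∀ n u, Measurable (G n u))
    (hq : 2 < q) (hρ : 0 < ρ) (hρ1 : ρ < 1) (herg : UniformlyErgodic P ε ε' G q CG ρ)
    (hmom : UniformlyBoundedMoments P ε G q CG) {k : ℕ → ℕ} (hk : Tendsto k atTop atTop)
    (hkn : (fun n => (k n : ℝ)) =o[atTop] (fun n : ℕ => (n : ℝ)))
    {p : ℝ} (hp : 1 ≤ p) (hp2 : p ≤ 2) {β C : ℝ≥0} {a : ℕ → ℝ≥0}
    {μ₁ μ₂ : ℕ → ℝ → EuclideanSpace ℝ (Fin d)}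
    (hμ : ∀ n : ℕ, 1 ≤ n → ∀ u ∈ Set.Icc (0 : ℝ) 1, localMean P ε (G n) u = μ₁ n u + μ₂ n u)
    (h₁ : ∀ n : ℕ, 1 ≤ n → HolderOnWith C β (μ₁ n) (Set.Icc (0 : ℝ) 1))
    (h₂ : ∀ n : ℕ, 1 ≤ n → pVariation p (μ₂ n) ≤ (a n : ℝ≥0∞))
    (ha : (fun n => (a n : ℝ)) =O[atTop] (fun _ => (1 : ℝ))) :
    IsBigOP P (fun n ω => 1 / (n : ℝ) * ∑ t ∈ Finset.Icc 1 n,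
        ‖localAverage ε G (k n) n t ω - localMean P ε (G n) ((t : ℝ) / n)‖ ^ 2)
      (fun n => (a n : ℝ) * k n / n + ((k n : ℝ) / n) ^ (2 * (β : ℝ)) + Real.log n / k n) := by
  intro η hη
  obtain ⟨K, hK, hKb⟩ := hε.exists_sum_squared_error_bound hG hq hρ hρ1 herg hmom hp hp2 C β
  obtain ⟨A, hA⟩ := ha.bound
  -- Markov's constant: |A| + 1 dominates both 1 and a_n eventually, so a² ≤ (|A| + 1) a.
  refine ⟨K * (|A| + 1) / η, ?_⟩
  filter_upwards [hA, hkn.bound one_pos, hk.eventually_ge_atTop 1, eventually_ge_atTop 3]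
    with n hAn hkn hk1 hn
  have hn1 : 1 ≤ n := by omega
  have hkn : k n ≤ n := by
    rw [one_mul, Real.norm_of_nonneg (by positivity), Real.norm_of_nonneg (by positivity)] at hkn
    exact_mod_cast hkn
  have haA : (a n : ℝ) ≤ |A| + 1 := by
    rw [Real.norm_of_nonneg (NNReal.coe_nonneg _), norm_one, mul_one] at hAn
    linarith [le_abs_self A]
  have hn0 : (0 : ℝ) < n := by exact_mod_cast hn1
  have hk0 : (0 : ℝ) < k n := by exact_mod_cast hk1
  have hlog := one_le_log_natCast hn
  have hb := hKb (a n) (μ₁ n) (μ₂ n) (k n) n hn hk1 hkn (hμ n hn1) (h₁ n hn1) (h₂ n hn1)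
  have hr : 0 < (a n : ℝ) * k n / n + ((k n : ℝ) / n) ^ (2 * (β : ℝ)) + Real.log n / k n := by
    positivity
  refine measure_abs_gt_le_of_integral_le (fun ω => by positivity)
    ((integrable_finsetSum _ fun t ht => hε.integrable_norm_localAverage_sub_sq hG hq hmom hn1
      (Finset.mem_Icc.mp ht).2 _).const_mul _) (mul_pos (by positivity) hr) ?_
  rw [integral_const_mul]
  calc 1 / (n : ℝ) * ∫ ω, ∑ t ∈ Finset.Icc 1 n,
        ‖localAverage ε G (k n) n t ω - localMean P ε (G n) ((t : ℝ) / n)‖ ^ 2 ∂P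
      ≤ 1 / (n : ℝ) * (K * ((a n : ℝ) ^ 2 * k n + n * ((k n : ℝ) / n) ^ (2 * (β : ℝ)) +
          n * Real.log n / k n)) := by gcongr
    _ = K * ((a n : ℝ) * ((a n : ℝ) * k n / n) + 1 * ((k n : ℝ) / n) ^ (2 * (β : ℝ)) +
          1 * (Real.log n / k n)) := by field_simp
    _ ≤ K * ((|A| + 1) * ((a n : ℝ) * k n / n) + (|A| + 1) * ((k n : ℝ) / n) ^ (2 * (β : ℝ)) +
          (|A| + 1) * (Real.log n / k n)) := by
        have h1A : 1 ≤ |A| + 1 := by linarith [abs_nonneg A]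
        have h0 : 0 ≤ Real.log n / k n := by positivity
        gcongr
    _ = _ := by field_simp

/-- The normalised sum tends to 0 in L_1, hence in probability; starting at τ_n ≥ 1 only drops
nonnegative terms. -/
theorem IIDWithCopy.squaredErrorConsistent (hε : IIDWithCopy P ε ε')
    (hG : ∀ n u, Measurable (G n u))
    (hq : 2 < q) (hρ : 0 < ρ) (hρ1 : ρ < 1) (herg : UniformlyErgodic P ε ε' G q CG ρ)
    (hmom : UniformlyBoundedMoments P ε G q CG) {k : ℕ → ℕ} (hk : Tendsto k atTop atTop)
    (hkn : (fun n => (k n : ℝ)) =o[atTop] (fun n : ℕ => (n : ℝ)))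
    {p : ℝ} (hp : 1 ≤ p) (hp2 : p ≤ 2) {β C : ℝ≥0} (hβ : 0 < β) {a : ℕ → ℝ≥0}
    {μ₁ μ₂ : ℕ → ℝ → EuclideanSpace ℝ (Fin d)}
    (hμ : ∀ n : ℕ, 1 ≤ n → ∀ u ∈ Set.Icc (0 : ℝ) 1, localMean P ε (G n) u = μ₁ n u + μ₂ n u)
    (h₁ : ∀ n : ℕ, 1 ≤ n → HolderOnWith C β (μ₁ n) (Set.Icc (0 : ℝ) 1))
    (h₂ : ∀ n : ℕ, 1 ≤ n → pVariation p (μ₂ n) ≤ (a n : ℝ≥0∞))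
    (hak : (fun n => (a n : ℝ) * k n) =o[atTop] (fun n : ℕ => Real.sqrt n))
    (hk1 : (fun n : ℕ => Real.sqrt n * Real.log n) =o[atTop] (fun n => (k n : ℝ)))
    (hk2 : (fun n => (k n : ℝ)) =o[atTop]
      (fun n : ℕ => (n : ℝ) ^ ((4 * (β : ℝ) - 1) / (4 * (β : ℝ)))))
    {τ : ℕ → ℕ} (hτ : ∀ n, 1 ≤ τ n) :
    SquaredErrorConsistent P (fun n t => localAverage ε G (k n) n t)
      (fun n => localMean P ε (G n)) τ := by
  obtain ⟨K, hK, hKb⟩ := hε.exists_sum_squared_error_bound hG hq hρ hρ1 herg hmom hp hp2 C β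
  have hlim : Tendsto (fun n : ℕ => K * ((a n : ℝ) * k n / √n +
      n * ((k n : ℝ) / n) ^ (2 * (β : ℝ)) / √n + √n * Real.log n / k n)) atTop (𝓝 0) := by
    have := ((hak.tendsto_div_nhds_zero.add (tendsto_rpow_mul_div_sqrt (β := β)
      (by exact_mod_cast hβ) hk2)).add hk1.tendsto_div_nhds_zero).const_mul K
    simpa using this
  have hmeas : ∀ n t, Measurable (localAverage ε G (k n) n t) := fun n t => by
    have h : Measurable fun ω => ∑ i ∈ Finset.Icc (max (t - k n) 1) t, obs ε G n i ω :=
      Finset.measurable_fun_sum _ fun i _ => (hG n ((i : ℝ) / n)).comp (hε.measurable_past i)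
    exact h.const_smul (((min (k n) t : ℕ) : ℝ)⁻¹)
  refine tendstoInMeasure_of_tendsto_eLpNorm one_ne_zero (fun n => ?_)
    aestronglyMeasurable_const ?_
  · refine Measurable.aestronglyMeasurable ?_
    exact (Finset.measurable_fun_sum _ fun t _ =>
      ((hmeas n t).sub_const _).norm.pow_const 2).div_const _
  refine tendsto_of_tendsto_of_tendsto_of_le_of_le' tendsto_const_nhds
    (by simpa using ENNReal.tendsto_ofReal hlim) (Eventually.of_forall fun n => zero_le) ?_
  filter_upwards [hak.bound one_pos, hk1.bound one_pos, hkn.bound one_pos,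
    hk.eventually_ge_atTop 1, eventually_ge_atTop 3] with n hak hk1 hkn hkpos hn
  have hn1 : 1 ≤ n := by omega
  have hlog := one_le_log_natCast hn
  have hn0 : (0 : ℝ) < n := by exact_mod_cast hn1
  have hk0 : (0 : ℝ) < k n := by exact_mod_cast hkpos
  have hsq : 0 < √(n : ℝ) := Real.sqrt_pos.mpr hn0
  have hkn : k n ≤ n := by
    rw [one_mul, Real.norm_of_nonneg (by positivity), Real.norm_of_nonneg (by positivity)] at hkn
    exact_mod_cast hkn
  rw [one_mul, Real.norm_of_nonneg (by positivity), Real.norm_of_nonneg (by positivity)] at hak hk1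
  -- Boundedness comes from the bandwidth: a k ≤ √n ≤ √n log n ≤ k eventually. Then a² ≤ a.
  have ha1 : (a n : ℝ) ≤ 1 := by
    have h1 : √(n : ℝ) ≤ k n :=
      (le_mul_of_one_le_right hsq.le hlog).trans hk1
    exact le_of_mul_le_mul_right (by rw [one_mul]; exact hak.trans h1) hk0
  have hb := hKb (a n) (μ₁ n) (μ₂ n) (k n) n hn hkpos hkn (hμ n hn1) (h₁ n hn1) (h₂ n hn1)
  have hint : ∀ s : ℕ, Integrable (fun ω => ∑ t ∈ Finset.Icc s n,
      ‖localAverage ε G (k n) n t ω - localMean P ε (G n) ((t : ℝ) / n)‖ ^ 2) P := fun s =>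
    integrable_finsetSum _ fun t ht => hε.integrable_norm_localAverage_sub_sq hG hq hmom hn1
      (Finset.mem_Icc.mp ht).2 _
  rw [eLpNorm_one_eq_lintegral_enorm]
  have e : ((fun ω => (∑ t ∈ Finset.Icc (τ n) n,
      ‖localAverage ε G (k n) n t ω - localMean P ε (G n) ((t : ℝ) / n)‖ ^ 2) / √n) - fun _ => 0) =
      fun ω => (∑ t ∈ Finset.Icc (τ n) n,
      ‖localAverage ε G (k n) n t ω - localMean P ε (G n) ((t : ℝ) / n)‖ ^ 2) / √n := by
    funext ω
    simp
  rw [e, ← ofReal_integral_norm_eq_lintegral_enorm ((hint _).div_const _)]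
  refine ENNReal.ofReal_le_ofReal ?_
  calc ∫ ω, ‖(∑ t ∈ Finset.Icc (τ n) n,
        ‖localAverage ε G (k n) n t ω - localMean P ε (G n) ((t : ℝ) / n)‖ ^ 2) / √n‖ ∂P
      ≤ ∫ ω, (∑ t ∈ Finset.Icc 1 n,
        ‖localAverage ε G (k n) n t ω - localMean P ε (G n) ((t : ℝ) / n)‖ ^ 2) / √n ∂P := by
        refine integral_mono ((hint _).div_const _).norm ((hint 1).div_const _) fun ω => ?_
        simp only
        rw [Real.norm_of_nonneg (by positivity)]
        refine div_le_div_of_nonneg_right ?_ hsq.le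
        exact Finset.sum_le_sum_of_subset_of_nonneg
          (Finset.Icc_subset_Icc_left (hτ n)) fun _ _ _ => by positivity
    _ ≤ K * ((a n : ℝ) ^ 2 * k n + n * ((k n : ℝ) / n) ^ (2 * (β : ℝ)) +
          n * Real.log n / k n) / √n := by
        rw [integral_div]
        gcongr
    _ ≤ K * ((a n : ℝ) * k n + n * ((k n : ℝ) / n) ^ (2 * (β : ℝ)) +
          n * Real.log n / k n) / √n := by
        have : (a n : ℝ) ^ 2 ≤ a n := by
          rw [sq]
          exact mul_le_of_le_one_left (NNReal.coe_nonneg _) ha1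
        gcongr
    _ = _ := by
        have h2 : n * Real.log n / k n = √(n : ℝ) * (√n * Real.log n / k n) := by
          rw [← mul_div_assoc, ← mul_assoc, Real.mul_self_sqrt hn0.le]
        rw [h2]
        field_simp

end LocStat

/-! ### Uniform consistency by a union bound. -/

theorem measure_norm_ge_le_of_eLpNorm_le {Ω E : Type*} [MeasurableSpace Ω] {P : Measure Ω}
    [NormedAddCommGroup E] {f : Ω → E} (hf : AEStronglyMeasurable f P) {q c δ : ℝ} (hq : 0 < q)
    (hc : 0 ≤ c) (hδ : 0 < δ) (h : eLpNorm f (ENNReal.ofReal q) P ≤ ENNReal.ofReal c) :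
    P {ω | δ ≤ ‖f ω‖} ≤ ENNReal.ofReal ((c / δ) ^ q) := by
  have h1 := meas_ge_le_mul_pow_eLpNorm_enorm P (by simpa using hq) ENNReal.ofReal_ne_top hf
    (ε := ENNReal.ofReal δ) (by simpa using hδ) (fun h => absurd h ENNReal.ofReal_ne_top)
  have e : {ω | δ ≤ ‖f ω‖} = {ω | ENNReal.ofReal δ ≤ ‖f ω‖ₑ} := by
    ext ω
    simp only [Set.mem_ofPred_eq]
    rw [← ofReal_norm, ENNReal.ofReal_le_ofReal_iff (norm_nonneg _)]
  rw [e]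
  refine h1.trans ?_
  rw [ENNReal.toReal_ofReal hq.le, ← ENNReal.mul_rpow_of_nonneg _ _ hq.le,
    ← ENNReal.ofReal_rpow_of_nonneg (by positivity) hq.le]
  refine ENNReal.rpow_le_rpow ?_ hq.le
  rw [div_eq_inv_mul, ENNReal.ofReal_mul (by positivity), ENNReal.ofReal_inv_of_pos hδ]
  gcongr

/-- The tail series converges since q/2 > 1, so it vanishes as τ → ∞. -/
theorem sum_rpow_min_le {q : ℝ} (hq : 2 < q) {k n τ : ℕ} (hτ : 1 ≤ τ) :
    ∑ t ∈ Finset.Icc τ n, ((min k t : ℕ) : ℝ) ^ (-(q / 2)) ≤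
      n * (k : ℝ) ^ (-(q / 2)) + ∑' i : ℕ, ((i + τ : ℕ) : ℝ) ^ (-(q / 2)) := by
  have hs : Summable fun i : ℕ => (i : ℝ) ^ (-(q / 2)) :=
    Real.summable_nat_rpow.mpr (by linarith)
  calc ∑ t ∈ Finset.Icc τ n, ((min k t : ℕ) : ℝ) ^ (-(q / 2))
      ≤ ∑ t ∈ Finset.Icc τ n, ((k : ℝ) ^ (-(q / 2)) + (t : ℝ) ^ (-(q / 2))) := by
        refine Finset.sum_le_sum fun t _ => ?_
        have h1 : 0 ≤ (k : ℝ) ^ (-(q / 2)) := by positivity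
        have h2 : 0 ≤ (t : ℝ) ^ (-(q / 2)) := by positivity
        rcases min_choice k t with h | h <;> rw [h] <;> linarith
    _ ≤ _ := by
        rw [Finset.sum_add_distrib]
        refine add_le_add ?_ ?_
        · rw [Finset.sum_const, Nat.card_Icc, nsmul_eq_mul]
          have : ((n + 1 - τ : ℕ) : ℝ) ≤ n := by exact_mod_cast (by omega)
          gcongr
        · rw [← Finset.Ico_succ_right_eq_Icc, Finset.sum_Ico_eq_sum_range]
          refine le_trans (le_of_eq (Finset.sum_congr rfl fun i _ => ?_))
            (((summable_nat_add_iff τ).mpr hs).sum_le_tsum _ fun i _ => by positivity)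
          rw [add_comm]

/-- The sequence is (n^(2/q)/k)^(q/2). -/
theorem tendsto_mul_rpow_neg {q : ℝ} (hq : 0 < q) {k : ℕ → ℕ}
    (h : (fun n : ℕ => (n : ℝ) ^ (2 / q)) =o[atTop] (fun n => (k n : ℝ))) :
    Tendsto (fun n : ℕ => n * (k n : ℝ) ^ (-(q / 2))) atTop (𝓝 0) := by
  have h1 := h.tendsto_div_nhds_zero.rpow_const (p := q / 2) (Or.inr (by linarith))
  rw [Real.zero_rpow (by linarith)] at h1
  refine h1.congr fun n => ?_
  rw [Real.div_rpow (by positivity) (by positivity), ← Real.rpow_mul (by positivity),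
    div_mul_div_cancel₀ hq.ne', div_self two_ne_zero, Real.rpow_one,
    Real.rpow_neg (by positivity), div_eq_mul_inv]

namespace LocStat

variable {Ω : Type*} [m0 : MeasurableSpace Ω] {P : Measure Ω} [IsProbabilityMeasure P]
  {ε ε' : ℤ → Ω → ℝ} {d : ℕ}
  {G : ℕ → ℝ → (ℕ → ℝ) → EuclideanSpace ℝ (Fin d)}
  {Glim : ℝ → (ℕ → ℝ) → EuclideanSpace ℝ (Fin d)} {q CG ρ : ℝ}

/-- Normalising by the true number of points makes this a convex combination, which `meanAverage` is
not when t > k. -/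
theorem windowAverage_mem_pathHull (μ : ℝ → EuclideanSpace ℝ (Fin d)) {k n t : ℕ} (ht : 1 ≤ t)
    (htn : t ≤ n) : windowAverage μ k n t ∈ pathHull μ := by
  have h := card_window_pos (k := k) ht
  rw [windowAverage, Finset.smul_sum]
  refine (convex_convexHull ℝ _).sum_mem (fun _ _ => by positivity) ?_ fun i hi =>
    subset_convexHull ℝ _ ⟨_, natCast_div_mem_Icc ((Finset.mem_Icc.mp hi).2.trans htn), rfl⟩
  rw [Finset.sum_const, nsmul_eq_mul, mul_inv_cancel₀ h.ne']

theorem norm_windowAverage_sub_windowAverage_le {f g : ℝ → EuclideanSpace ℝ (Fin d)} {b : ℝ}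
    {k n t : ℕ} (ht : 1 ≤ t) (htn : t ≤ n) (hb : ∀ u ∈ Set.Icc (0 : ℝ) 1, ‖f u - g u‖ ≤ b) :
    ‖windowAverage f k n t - windowAverage g k n t‖ ≤ b := by
  have h : windowAverage f k n t - windowAverage g k n t =
      windowAverage (fun u => f u - g u) k n t - 0 := by
    rw [windowAverage, windowAverage, windowAverage, ← smul_sub, ← Finset.sum_sub_distrib, sub_zero]
  rw [h]
  refine norm_windowAverage_sub_const_le _ ht fun i hi => ?_
  rw [sub_zero]
  exact hb _ (natCast_div_mem_Icc ((Finset.mem_Icc.mp hi).2.trans htn))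

theorem IIDWithCopy.eventually_norm_localMean_sub_le (hε : IIDWithCopy P ε ε')
    (hG : ∀ n u, Measurable (G n u)) (hq : 2 < q) (hmom : UniformlyBoundedMoments P ε G q CG)
    (hGlim : ∀ u, Measurable (Glim u)) (hconv : KernelConverges P ε G Glim q) {c : ℝ}
    (hc : 0 < c) :
    ∀ᶠ n in atTop, ∀ u ∈ Set.Icc (0 : ℝ) 1,
      ‖localMean P ε (G n) u - localMean P ε Glim u‖ ≤ c := by
  have h1q : (1 : ℝ≥0∞) ≤ ENNReal.ofReal q := one_le_ofReal (by linarith)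
  filter_upwards [hconv.eventually (eventually_le_nhds (ENNReal.ofReal_pos.mpr hc)),
    eventually_ge_atTop 1] with n hn hn1 u hu
  have h2 : eLpNorm (fun ω => G n u (past ε 0 ω) - Glim u (past ε 0 ω)) (ENNReal.ofReal q) P ≤
      ENNReal.ofReal c := (le_iSup₂ (f := fun u (_ : u ∈ Set.Icc (0 : ℝ) 1) =>
        eLpNorm (fun ω => G n u (past ε 0 ω) - Glim u (past ε 0 ω)) (ENNReal.ofReal q) P)
        u hu).trans hn
  have hGn := hε.memLp_past hG hmom hn1 hu 0
  have hm : MemLp (fun ω => G n u (past ε 0 ω) - Glim u (past ε 0 ω)) (ENNReal.ofReal q) P :=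
    ⟨(((hG n u).comp (hε.measurable_past 0)).sub
      ((hGlim u).comp (hε.measurable_past 0))).aestronglyMeasurable,
      h2.trans_lt ENNReal.ofReal_lt_top⟩
  have hl : MemLp (fun ω => Glim u (past ε 0 ω)) (ENNReal.ofReal q) P := by
    have := hGn.sub hm
    simpa [Pi.sub_def] using this
  rw [localMean, localMean, ← integral_sub (hGn.integrable h1q) (hl.integrable h1q)]
  exact norm_integral_le_of_eLpNorm_le hm.1 h1q hc.le h2

theorem IIDWithCopy.uniformlyConsistent (hε : IIDWithCopy P ε ε') (hG : ∀ n u, Measurable (G n u))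
    (hq : 2 < q) (hρ : 0 < ρ) (hρ1 : ρ < 1) (herg : UniformlyErgodic P ε ε' G q CG ρ)
    (hmom : UniformlyBoundedMoments P ε G q CG) {k : ℕ → ℕ} (hk : Tendsto k atTop atTop)
    (hGlim : ∀ u, Measurable (Glim u)) (hconv : KernelConverges P ε G Glim q)
    (hkq : (fun n : ℕ => (n : ℝ) ^ (2 / q)) =o[atTop] (fun n => (k n : ℝ)))
    {δ : ℝ≥0∞} (hδ : 0 < δ) {τ : ℕ → ℕ} (hτ : Tendsto τ atTop atTop) :
    UniformlyConsistent P (fun n t => localAverage ε G (k n) n t) (localMean P ε Glim) δ τ := by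
  -- A finite η also when δ = ∞. Each of three errors gets η: noise, normalisation, and the distance
  -- from the means of G_n to those of the limit.
  obtain ⟨η, hη0, hηδ⟩ : ∃ η : ℝ, 0 < η ∧ ENNReal.ofReal (3 * η) ≤ δ := by
    obtain ⟨r, hr, hrδ⟩ := ENNReal.lt_iff_exists_nnreal_btwn.mp hδ
    have hr' : (0 : ℝ) < r := by exact_mod_cast hr
    exact ⟨r / 3, by positivity, by
      rw [mul_div_cancel₀ _ (by norm_num : (3 : ℝ) ≠ 0), ENNReal.ofReal_coe_nnreal]
      exact hrδ.le⟩
  obtain ⟨K, hK, hKb⟩ := hε.exists_localAverage_bound hG hq hρ hρ1 herg hmom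
  set b := max CG 0 with hb
  set R : ℕ → ℝ := fun n => (K / η) ^ q * (n * (k n : ℝ) ^ (-(q / 2)) +
    ∑' i : ℕ, ((i + τ n : ℕ) : ℝ) ^ (-(q / 2))) with hR
  have hRlim : Tendsto R atTop (𝓝 0) := by
    have h1 := (tendsto_sum_nat_add fun i : ℕ => (i : ℝ) ^ (-(q / 2))).comp hτ
    have h2 := ((tendsto_mul_rpow_neg (by linarith) hkq).add h1).const_mul ((K / η) ^ q)
    simpa [hR] using h2
  have hbk : ∀ᶠ n in atTop, b / (k n : ℝ) ≤ η := by
    have : Tendsto (fun n => b / (k n : ℝ)) atTop (𝓝 0) :=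
      (tendsto_natCast_atTop_atTop.comp hk).const_div_atTop b
    exact this.eventually (eventually_le_nhds hη0)
  have hlow : ∀ᶠ n in atTop, 1 - ENNReal.ofReal (R n) ≤
      P {ω | ∀ t : ℕ, τ n ≤ t → t ≤ n →
        localAverage ε G (k n) n t ω ∈ neighborhood δ (pathHull (localMean P ε Glim))} := by
    filter_upwards [hbk, hk.eventually_ge_atTop 1, hτ.eventually_ge_atTop 1,
      eventually_ge_atTop 1,
      hε.eventually_norm_localMean_sub_le hG hq hmom hGlim hconv hη0] with n hbk hk1 hτ1 hn hμ
    set good := {ω | ∀ t : ℕ, τ n ≤ t → t ≤ n →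
        localAverage ε G (k n) n t ω ∈ neighborhood δ (pathHull (localMean P ε Glim))}
    set Z : ℕ → Ω → EuclideanSpace ℝ (Fin d) := fun t ω =>
      localAverage ε G (k n) n t ω - meanAverage (localMean P ε (G n)) (k n) n t with hZ
    have hbad : goodᶜ ⊆ ⋃ t ∈ Finset.Icc (τ n) n, {ω | η ≤ ‖Z t ω‖} := by
      intro ω hω
      by_contra hno
      refine hω fun t hτt htn => ⟨windowAverage (localMean P ε Glim) (k n) n t,
        windowAverage_mem_pathHull _ (hτ1.trans hτt) htn, ?_⟩
      have hZt : ‖Z t ω‖ < η := by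
        by_contra hge
        exact hno (Set.mem_iUnion₂.mpr ⟨t, Finset.mem_Icc.mpr ⟨hτt, htn⟩, not_lt.mp hge⟩)
      have h1 := norm_meanAverage_sub_windowAverage_le hk1 (hτ1.trans hτt) htn
        (fun u hu => hε.norm_localMean_le hG hq hmom hn hu)
      have h2 := norm_windowAverage_sub_windowAverage_le (k := k n) (hτ1.trans hτt) htn hμ
      have h3 := norm_add₃_le (a := Z t ω)
        (b := meanAverage (localMean P ε (G n)) (k n) n t -
          windowAverage (localMean P ε (G n)) (k n) n t)
        (c := windowAverage (localMean P ε (G n)) (k n) n t -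
          windowAverage (localMean P ε Glim) (k n) n t)
      rw [hZ] at h3
      simp only [sub_add_sub_cancel] at h3
      rw [edist_dist, dist_eq_norm]
      refine lt_of_lt_of_le ((ENNReal.ofReal_lt_ofReal_iff (by positivity)).mpr ?_) hηδ
      simp only [hZ] at hZt
      linarith
    have hZt : ∀ t ∈ Finset.Icc (τ n) n, P {ω | η ≤ ‖Z t ω‖} ≤
        ENNReal.ofReal ((K / η) ^ q * ((min (k n) t : ℕ) : ℝ) ^ (-(q / 2))) := by
      intro t ht
      obtain ⟨hτt, htn⟩ := Finset.mem_Icc.mp ht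
      have hm := ((hε.memLp_localAverage (k := k n) hG hmom hn htn).sub
        (memLp_const (μ := P) (meanAverage (localMean P ε (G n)) (k n) n t))).1
      refine (measure_norm_ge_le_of_eLpNorm_le (f := Z t) hm (by linarith) (by positivity) hη0
        (hKb (k n) n t hk1 (hτ1.trans hτt) htn)).trans (le_of_eq ?_)
      rw [div_right_comm, Real.div_rpow (by positivity) (by positivity), Real.sqrt_eq_rpow,
        ← Real.rpow_mul (by positivity), Real.rpow_neg (by positivity), div_eq_mul_inv]
      congr 4
      ring
    have hbadP : P goodᶜ ≤ ENNReal.ofReal (R n) := by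
      refine (measure_mono hbad).trans ((measure_biUnion_finset_le _ _).trans
        ((Finset.sum_le_sum hZt).trans ?_))
      rw [← ENNReal.ofReal_sum_of_nonneg fun t _ => by positivity, ← Finset.mul_sum]
      refine ENNReal.ofReal_le_ofReal ?_
      have := sum_rpow_min_le (k := k n) (n := n) hq hτ1
      simp only [hR]
      gcongr
    rw [tsub_le_iff_right]
    -- Subadditivity suffices, so measurability of `good` plays no role.
    calc (1 : ℝ≥0∞) = P (good ∪ goodᶜ) := by rw [Set.union_compl_self, measure_univ]
      _ ≤ P good + P goodᶜ := measure_union_le _ _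
      _ ≤ _ := by gcongr
  refine tendsto_of_tendsto_of_tendsto_of_le_of_le' ?_ tendsto_const_nhds hlow
    (Eventually.of_forall fun n => prob_le_one)
  have h := ENNReal.Tendsto.sub (tendsto_const_nhds (x := (1 : ℝ≥0∞)))
    (ENNReal.tendsto_ofReal hRlim) (Or.inl ENNReal.one_ne_top)
  simpa using h

end LocStat

theorem proposition1 {Ω : Type*} [MeasurableSpace Ω] (P : Measure Ω) [IsProbabilityMeasure P]
    (ε ε' : ℤ → Ω → ℝ) (hε : IIDWithCopy P ε ε')
    (d : ℕ) (G : ℕ → ℝ → (ℕ → ℝ) → EuclideanSpace ℝ (Fin d)) (hG : ∀ n u, Measurable (G n u))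
    (q CG ρ : ℝ) (hq : 2 < q) (hρ : 0 < ρ) (hρ1 : ρ < 1)
    (herg : UniformlyErgodic P ε ε' G q CG ρ)
    (hmom : UniformlyBoundedMoments P ε G q CG)
    (k : ℕ → ℕ) (hk : Tendsto k atTop atTop)
    (hkn : (fun n => (k n : ℝ)) =o[atTop] (fun n : ℕ => (n : ℝ))) :
    -- uniform consistency
    (∀ Glim : ℝ → (ℕ → ℝ) → EuclideanSpace ℝ (Fin d), (∀ u, Measurable (Glim u)) →
      KernelConverges P ε G Glim q →
      (fun n : ℕ => (n : ℝ) ^ (2 / q)) =o[atTop] (fun n => (k n : ℝ)) →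
      ∀ δ : ℝ≥0∞, 0 < δ → ∀ τ : ℕ → ℕ, Tendsto τ atTop atTop →
        UniformlyConsistent P (fun n t => localAverage ε G (k n) n t) (localMean P ε Glim) δ τ) ∧
    -- rate of the mean squared error, and squared-error consistency
    (∀ (p : ℝ) (β C : ℝ≥0) (a : ℕ → ℝ≥0) (μ₁ μ₂ : ℕ → ℝ → EuclideanSpace ℝ (Fin d)),
      1 ≤ p → p < 2 → 0 < β →
      (∀ n : ℕ, 1 ≤ n → ∀ u ∈ Set.Icc (0 : ℝ) 1, localMean P ε (G n) u = μ₁ n u + μ₂ n u) →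
      (∀ n : ℕ, 1 ≤ n → HolderOnWith C β (μ₁ n) (Set.Icc (0 : ℝ) 1)) →
      (∀ n : ℕ, 1 ≤ n → pVariation p (μ₂ n) ≤ (a n : ℝ≥0∞)) →
      ((fun n => (a n : ℝ)) =O[atTop] (fun _ => (1 : ℝ)) →
        IsBigOP P
          (fun n ω => 1 / (n : ℝ) * ∑ t ∈ Finset.Icc 1 n,
            ‖localAverage ε G (k n) n t ω - localMean P ε (G n) ((t : ℝ) / n)‖ ^ 2)
          (fun n => (a n : ℝ) * k n / n + ((k n : ℝ) / n) ^ (2 * (β : ℝ)) + Real.log n / k n)) ∧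
      ((fun n => (a n : ℝ) * k n) =o[atTop] (fun n : ℕ => Real.sqrt n) →
        (fun n : ℕ => Real.sqrt n * Real.log n) =o[atTop] (fun n => (k n : ℝ)) →
        (fun n => (k n : ℝ)) =o[atTop]
          (fun n : ℕ => (n : ℝ) ^ ((4 * (β : ℝ) - 1) / (4 * (β : ℝ)))) →
        ∀ τ : ℕ → ℕ, (∀ n, 1 ≤ τ n) →
          SquaredErrorConsistent P (fun n t => localAverage ε G (k n) n t)
            (fun n => localMean P ε (G n)) τ)) ∧
    -- feasibility of the bandwidth condition
    (∀ β : ℝ, 1 / 2 < β → ∃ κ : ℕ → ℕ,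
      (fun n : ℕ => Real.sqrt n * Real.log n) =o[atTop] (fun n => (κ n : ℝ)) ∧
      (fun n => (κ n : ℝ)) =o[atTop] (fun n : ℕ => (n : ℝ) ^ ((4 * β - 1) / (4 * β)))) := by
  refine ⟨fun Glim hGlim hconv hkq δ hδ τ hτ =>
    hε.uniformlyConsistent hG hq hρ hρ1 herg hmom hk hGlim hconv hkq hδ hτ,
    fun p β C a μ₁ μ₂ hp hp2 hβ hμ h₁ h₂ =>
      ⟨fun ha => hε.isBigOP_mean_squared_error hG hq hρ hρ1 herg hmom hk hkn hp hp2.le hμ h₁ h₂ ha,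
        fun hak hk1 hk2 τ hτ => hε.squaredErrorConsistent hG hq hρ hρ1 herg hmom hk hkn hp hp2.le
          hβ hμ h₁ h₂ hak hk1 hk2 hτ⟩,
    fun β hβ => exists_bandwidth hβ⟩
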